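/- Let $0<d<1/2$ be constant and put $\theta=\ln(1/d)$. Digraphs on the vertex set $[n]$ have arc sets contained in $[n]^2$; let $\mathcal D(n,d)$ be the set of those in which every vertex has out-degree at least $dn$ and in-degree at least $dn$. For $H\in\mathcal D(n,d)$ and an integer $0\le m\le |[n]^2\setminus A(H)|$, where $A(H)$ is the arc set of $H$, let $R$ be a uniformly random $m$-element subset of $[n]^2\setminus A(H)$ and let $D=H+R$ be the digraph obtained from $H$ by adding the arcs in $R$. A digraph is Hamiltonian if it has a directed cycle through all of its vertices. (a) For every $\varepsilon>0$ there is $n_0$ such that for all $n\ge n_0$, all $H\in\mathcal D(n,d)$ and all integers $m$ with $\left(d^{-1}(15+6\theta)+5d^{-2}\right)n\le m\le |[n]^2\setminus A(H)|$, the digraph $D$ is Hamiltonian with probability at least $1-\varepsilon$. (b) If $d\le 1/10$, then there are digraphs $H_n$ ($n\ge 3$) such that $H_n\in\mathcal D(n,d)$, such that $H_n$ is obtained from a complete bipartite graph on $[n]$ with parts of different sizes by replacing each edge by two opposite arcs, and such that the following holds. For every $\varepsilon>0$ there is $n_0$ such that for all $n\ge n_0$ and all integers $0\le m<\theta n/3$,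 the digraph $D=H_n+R$ is not Hamiltonian with probability at least $1-\varepsilon$. -/

import Mathlib

open Filter Finset

open scoped Classical in
/-- Out-degree of `v`: the number of arcs `(v, w)`. -/
noncomputable def outDeg {V : Type*} [Fintype V] (H : Digraph V) (v : V) : ℕ :=
  (univ.filter fun w => H.Adj v w).card

open scoped Classical in
/-- In-degree of `v`: the number of arcs `(w, v)`. -/
noncomputable def inDeg {V : Type*} [Fintype V] (H : Digraph V) (v : V) : ℕ :=
  (univ.filter fun w => H.Adj w v).card

/-- The class `𝒟(n, d)`: digraphs on `n` labelled vertices all of whose out-degrees and in-degrees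
are at least `d n`. -/
def DenseDigraphs (n : ℕ) (d : ℝ) : Set (Digraph (Fin n)) :=
  {H | ∀ v, d * n ≤ outDeg H v ∧ d * n ≤ inDeg H v}

open scoped Classical in
/-- The ordered pairs of vertices that are not arcs of `H`, that is `[n]² \ A(H)`. -/
noncomputable def nonArcs {V : Type*} [Fintype V] (H : Digraph V) : Finset (V × V) :=
  univ.filter fun p => ¬ H.Adj p.1 p.2

/-- The digraph `H + R`, obtained from `H` by adding the arcs in `R`. -/
def addArcs {V : Type*} (H : Digraph V) (R : Finset (V × V)) : Digraph V where
  Adj x y := H.Adj x y ∨ (x, y) ∈ R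

/-- `D` has a directed Hamilton cycle: a cyclic enumeration of all the vertices in which every
vertex sends an arc to the next one. -/
def IsHamiltonianDigraph {V : Type*} [Fintype V] (D : Digraph V) : Prop :=
  ∃ c : ZMod (Fintype.card V) ≃ V, ∀ i, D.Adj (c i) (c (i + 1))

open scoped Classical in
/-- The probability that `H + R` has the property `P`, where `R` is uniformly distributed over the
`m`-element subsets of `nonArcs H`. Meaningful for `m ≤ (nonArcs H).card`. -/
noncomputable def randomArcProb {V : Type*} [Fintype V] (H : Digraph V) (m : ℕ)
    (P : Digraph V → Prop) : ℝ :=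
  (((nonArcs H).powersetCard m).filter fun R => P (addArcs H R)).card /
    ((nonArcs H).powersetCard m).card

/-- `H` is the bidirected complete bipartite digraph on two classes of different sizes: a class `A`
with fewer than half of the vertices, and its complement. -/
def IsUnbalancedBipartite {V : Type*} [Fintype V] (H : Digraph V) : Prop :=
  ∃ A : Finset V, 2 * A.card < Fintype.card V ∧
    ∀ x y, H.Adj x y ↔ ((x ∈ A ∧ y ∉ A) ∨ (x ∉ A ∧ y ∈ A))

/-!
A cycle cover of a digraph is a permutation `σ` all of whose pairs `(v, σ v)` are arcs, and a
Hamilton cycle is a cycle cover with a single cycle. Everything is done by multiplying cycle covers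
by short cyclic permutations.

*Enough random arcs.* The uniformly random `m`-set of new arcs is replaced by `m` independent,
uniformly random pairs of vertices, which may repeat or coincide with old arcs; since being
Hamiltonian is increasing, this only decreases its probability (`levelCount_le_seqProb`, by the local
LYM inequality), and independent pairs can be exposed in rounds (`seqProb_add_le`).

The first `m - n` pairs almost surely join any two sets of `d n / 4` vertices
(`eventually_seqProb_not_setsJoined_le`, a union bound). From then on the argument is deterministic
until all cycles have linear length: a cycle cover exists by Hall's theorem, and if `v` lies on a
shortest cycle, of length `s ≤ d n / 8`, then there are about `d n` vertices `a` elsewhere with an arc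
`v → σ a`, and about as many `x` with an arc `x → σ v`. Halving these two sets along the cycles yields
an arc `a → σ x` such that `a` is not met within `s` steps after `x`. Replacing the arcs at `v`, `a`,
`x` by these three splices the short cycle into the others and leaves only longer cycles in its place
(`exists_rotate3`, `rotate3_pow_ne`, `exists_isCycleCover_of_joined`).

The last `n` pairs merge the boundedly many cycles that are left. If many arcs lead from the cycle of
`v` to other cycles, a single fresh arc completes an exchange of two arcs (`merge_swap`). Otherwise
there are many arcs `x → σ y` inside the cycle; a fresh path `y → σ w`, `w → σ z`, `z → σ x` with `z`
after `y` and with `w` on another cycle merges the two cycles (`merge_cycle4`). Such a path is found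
by exposing its arcs backwards, in three rounds which provide about `n ^ (1 / 2)` and `n ^ (1 / 4)`
candidates for `z` and `w` (`seqProb_not_mergeable_le_of_inside`).

*Too few random arcs.* In the complete bipartite digraph with classes of `k = ⌈d n⌉` and `n - k`
vertices, a vertex of the larger class that receives no random arc from its own class must be preceded
by a vertex of the smaller class on any Hamilton cycle, so that there are at most `k` such vertices.
Their expected number is at least about `(1 - d) n √d`, which is far above `k`, and Chebyshev's
inequality applies, the corresponding events being negatively correlated (`card_filter_avoided_le`).
-/

/-! ### Independent uniform sampling -/

section Sampling

variable {α : Type*} [Fintype α] [DecidableEq α]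

open scoped Classical in
/-- The probability that the set of values of a sequence of `m` independent, uniformly distributed
elements of `α` satisfies `P`; the sequence is sampled one term at a time. -/
noncomputable def seqProb : ℕ → (Finset α → Prop) → ℝ
  | 0, P => if P ∅ then 1 else 0
  | m + 1, P => (∑ a, seqProb m fun T => P (insert a T)) / Fintype.card α

open scoped Classical in
theorem seqProb_zero (P : Finset α → Prop) : seqProb 0 P = if P ∅ then 1 else 0 := by
  rw [seqProb]

theorem seqProb_succ (m : ℕ) (P : Finset α → Prop) :
    seqProb (m + 1) P = (∑ a, seqProb m fun T => P (insert a T)) / Fintype.card α := by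
  rw [seqProb]

theorem seqProb_le_one (m : ℕ) (P : Finset α → Prop) : seqProb m P ≤ 1 := by
  induction m generalizing P with
  | zero => rw [seqProb_zero]; split_ifs <;> norm_num
  | succ m ih =>
    simp only [seqProb_succ]
    calc _ ≤ (∑ _a : α, (1 : ℝ)) / Fintype.card α := by gcongr with a; exact ih _
      _ ≤ 1 := by simpa using div_self_le_one _

theorem seqProb_mono (m : ℕ) {P Q : Finset α → Prop} (h : ∀ T, P T → Q T) :
    seqProb m P ≤ seqProb m Q := by
  induction m generalizing P Q with
  | zero =>
    simp only [seqProb_zero]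
    have := h ∅
    split_ifs <;> simp_all
  | succ m ih =>
    simp only [seqProb_succ]
    gcongr with a
    exact ih fun T hT => h _ hT

theorem seqProb_or (m : ℕ) (P Q : Finset α → Prop) :
    seqProb m (fun T => P T ∨ Q T) ≤ seqProb m P + seqProb m Q := by
  induction m generalizing P Q with
  | zero =>
    simp only [seqProb_zero]
    split_ifs <;> simp_all
  | succ m ih =>
    simp only [seqProb_succ]
    rw [← add_div, ← sum_add_distrib]
    gcongr with a
    exact ih _ _

theorem seqProb_eq_zero (m : ℕ) {P : Finset α → Prop} (h : ∀ T, ¬ P T) : seqProb m P = 0 := by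
  induction m generalizing P with
  | zero => rw [seqProb_zero]; simp [h]
  | succ m ih => rw [seqProb_succ]; simp [ih fun T => h _]

theorem seqProb_exists {ι : Type*} (m : ℕ) (s : Finset ι) (P : ι → Finset α → Prop) :
    seqProb m (fun T => ∃ i ∈ s, P i T) ≤ ∑ i ∈ s, seqProb m (P i) := by
  classical
  induction s using Finset.induction_on with
  | empty => rw [seqProb_eq_zero]; · simp
             simp
  | insert i s hi ih =>
    rw [sum_insert hi]
    refine le_trans (seqProb_mono m (Q := fun T => P i T ∨ ∃ j ∈ s, P j T) ?_)
      ((seqProb_or m _ _).trans (by gcongr))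
    rintro T ⟨j, hj, hT⟩
    rcases mem_insert.1 hj with rfl | hj
    · exact Or.inl hT
    · exact Or.inr ⟨j, hj, hT⟩

/-- Exposing the sample in two rounds: a failure is due either to the first round, or to the second
round after a successful first one. -/
theorem seqProb_add_le (m₁ m₂ : ℕ) (P G : Finset α → Prop) {ε : ℝ} (hε : 0 ≤ ε)
    (h : ∀ S, G S → seqProb m₂ (fun T => P (S ∪ T)) ≤ ε) :
    seqProb (m₁ + m₂) P ≤ seqProb m₁ (fun S => ¬ G S) + ε := by
  induction m₁ generalizing P G with
  | zero =>
    rw [Nat.zero_add]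
    have h0 := h ∅
    have h1 := seqProb_le_one m₂ P
    simp only [empty_union] at h0
    change _ → seqProb m₂ P ≤ ε at h0
    rw [seqProb_zero]
    by_cases hG : G ∅
    · simpa [hG] using h0 hG
    · rw [if_pos hG]; linarith
  | succ m₁ ih =>
    rw [show m₁ + 1 + m₂ = (m₁ + m₂) + 1 by omega]
    simp only [seqProb_succ]
    have key : ∀ a : α, seqProb (m₁ + m₂) (fun T => P (insert a T)) ≤
        seqProb m₁ (fun S => ¬ G (insert a S)) + ε := by
      intro a
      exact ih _ (fun S => G (insert a S)) fun S hS => by simpa only [insert_union] using h _ hS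
    calc _ ≤ (∑ a : α, (seqProb m₁ (fun S => ¬ G (insert a S)) + ε)) / Fintype.card α := by
            gcongr with a; exact key a
      _ = (∑ a : α, seqProb m₁ (fun S => ¬ G (insert a S))) / Fintype.card α +
            (Fintype.card α : ℝ) / Fintype.card α * ε := by
            rw [sum_add_distrib, add_div, sum_const, card_univ, nsmul_eq_mul]; ring
      _ ≤ _ := by
            gcongr
            exact mul_le_of_le_one_left hε (div_self_le_one _)

theorem seqProb_disjoint_le [Nonempty α] (m : ℕ) (E : Finset α) :
    seqProb m (fun T => Disjoint T E) ≤ Real.exp (-(m * E.card / Fintype.card α)) := by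
  have hc : (0 : ℝ) < Fintype.card α := by exact_mod_cast Fintype.card_pos
  have key : seqProb m (fun T => Disjoint T E) = (1 - E.card / Fintype.card α : ℝ) ^ m := by
    induction m with
    | zero => rw [seqProb_zero]; simp
    | succ m ih =>
      simp only [seqProb_succ]
      have : ∀ a : α, seqProb m (fun T => Disjoint (insert a T) E) =
          if a ∈ Eᶜ then (1 - E.card / Fintype.card α : ℝ) ^ m else 0 := by
        intro a
        split_ifs with ha
        · rw [← ih]; simp only [disjoint_insert_left]; simp_all
        · exact seqProb_eq_zero m fun T => by simp_all [disjoint_insert_left]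
      simp only [this, sum_ite_mem, univ_inter, sum_const, nsmul_eq_mul]
      rw [card_compl, Nat.cast_sub (card_le_univ E)]
      rw [pow_succ', mul_div_right_comm, sub_div, div_self hc.ne']
  rw [key, mul_div_assoc, ← mul_neg, Real.exp_nat_mul]
  have h1 : (E.card : ℝ) / Fintype.card α ≤ 1 := by
    rw [div_le_one hc]; exact_mod_cast card_le_univ E
  refine pow_le_pow_left₀ (by linarith) ?_ m
  linarith [Real.add_one_le_exp (-((E.card : ℝ) / Fintype.card α))]

end Sampling

/-! ### Comparison of the two random models -/

section Comparison

variable {α : Type*} [DecidableEq α]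

open scoped Classical in
/-- The number of `m`-subsets of `N` satisfying `P`. -/
noncomputable def levelCount (N : Finset α) (m : ℕ) (P : Finset α → Prop) : ℕ :=
  ((N.powersetCard m).filter P).card

/-- Double counting of the pairs `(a, T)` with `a ∈ N` and `insert a T` satisfying `P`, according to
whether `a` belongs to `T` or not. -/
theorem sum_levelCount_insert (N : Finset α) (m : ℕ) (P : Finset α → Prop) :
    ∑ a ∈ N, levelCount N m (fun T => P (insert a T)) =
      (m + 1) * levelCount N (m + 1) P + m * levelCount N m P := by
  classical
  have split : ∀ a ∈ N, levelCount N m (fun T => P (insert a T)) =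
      (((N.powersetCard (m + 1)).filter P).filter (a ∈ ·)).card +
        (((N.powersetCard m).filter P).filter (a ∈ ·)).card := by
    intro a ha
    unfold levelCount
    rw [← card_filter_add_card_filter_not (fun T : Finset α => a ∉ T)]
    congr 1
    · refine card_bij' (fun T _ => insert a T) (fun T _ => T.erase a) ?_ ?_ ?_ ?_
      · intro T hT
        simp only [mem_filter, mem_powersetCard] at hT ⊢
        exact ⟨⟨⟨insert_subset ha hT.1.1.1, by rw [card_insert_of_notMem hT.2, hT.1.1.2]⟩, hT.1.2⟩,
          mem_insert_self _ _⟩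
      · intro T hT
        simp only [mem_filter, mem_powersetCard] at hT ⊢
        refine ⟨⟨⟨(erase_subset _ _).trans hT.1.1.1, ?_⟩, ?_⟩, notMem_erase _ _⟩
        · rw [card_erase_of_mem hT.2, hT.1.1.2]; rfl
        rw [insert_erase hT.2]; exact hT.1.2
      · intro T hT
        simp only [mem_filter] at hT
        exact erase_insert hT.2
      · intro T hT
        simp only [mem_filter] at hT
        exact insert_erase hT.2
    · congr 1
      ext T
      simp only [mem_filter, not_not]
      constructor
      · rintro ⟨⟨h1, h2⟩, h3⟩; rw [insert_eq_of_mem h3] at h2; exact ⟨⟨h1, h2⟩, h3⟩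
      · rintro ⟨⟨h1, h2⟩, h3⟩; exact ⟨⟨h1, by rwa [insert_eq_of_mem h3]⟩, h3⟩
  have count : ∀ j, ∑ a ∈ N, (((N.powersetCard j).filter P).filter (a ∈ ·)).card =
      j * levelCount N j P := by
    intro j
    have := sum_card_bipartiteAbove_eq_sum_card_bipartiteBelow (s := N)
      (t := (N.powersetCard j).filter P) (fun a T => a ∈ T)
    simp only [bipartiteAbove, bipartiteBelow] at this
    rw [this]
    unfold levelCount
    rw [mul_comm, ← smul_eq_mul, ← sum_const]
    refine sum_congr rfl fun T hT => ?_
    simp only [mem_filter, mem_powersetCard] at hT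
    rw [filter_mem_eq_inter, inter_eq_right.2 hT.1.1, hT.1.2]
  rw [sum_congr rfl split, sum_add_distrib, count, count]

/-- The local LYM inequality for a decreasing property. -/
theorem levelCount_succ_le (N : Finset α) (m : ℕ) {P : Finset α → Prop}
    (hP : ∀ a T, P (insert a T) → P T) :
    ((m : ℝ) + 1) * levelCount N (m + 1) P ≤ ((N.card : ℝ) - m) * levelCount N m P := by
  classical
  have h1 := sum_levelCount_insert N m P
  have h2 : ∑ a ∈ N, levelCount N m (fun T => P (insert a T)) ≤ ∑ _a ∈ N, levelCount N m P := by
    refine sum_le_sum fun a _ => ?_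
    unfold levelCount
    exact card_le_card fun T hT => by
      rw [mem_filter] at hT ⊢; exact ⟨hT.1, hP a T hT.2⟩
  rw [sum_const, smul_eq_mul, h1] at h2
  have h3 : ((m : ℝ) + 1) * levelCount N (m + 1) P + m * levelCount N m P ≤
      N.card * levelCount N m P := by exact_mod_cast h2
  linarith

/-- A decreasing property which only depends on the elements of `N` is at most as likely for a
uniformly random `m`-subset of `N` as for the set of values of a sequence of `m` uniformly random
elements of the whole space: that set meets `N` in at most `m` elements. -/
theorem levelCount_le_seqProb [Fintype α] [Nonempty α] (N : Finset α) (m : ℕ) (hm : m ≤ N.card)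
    (P : Finset α → Prop) (hP : ∀ a T, P (insert a T) → P T)
    (hN : ∀ a, a ∉ N → ∀ T, P T → P (insert a T)) :
    (levelCount N m P : ℝ) / N.card.choose m ≤ seqProb m P := by
  induction m generalizing P with
  | zero =>
    rw [seqProb_zero]; unfold levelCount
    simp only [powersetCard_zero, filter_singleton]
    split_ifs <;> simp
  | succ m ih =>
    have hm' : m ≤ N.card := by omega
    have hc : (0 : ℝ) < Fintype.card α := by exact_mod_cast Fintype.card_pos
    have hch : (0 : ℝ) < N.card.choose m := by exact_mod_cast Nat.choose_pos hm'
    have hch' : (0 : ℝ) < N.card.choose (m + 1) := by exact_mod_cast Nat.choose_pos hm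
    have hcc : (N.card.choose (m + 1) : ℝ) * (m + 1) = N.card.choose m * (N.card - m) := by
      have := Nat.choose_succ_right_eq N.card m
      rw [← Nat.cast_sub hm']
      exact_mod_cast this
    have hNm : (m : ℝ) + 1 ≤ N.card := by exact_mod_cast hm
    have hLYM := levelCount_succ_le N m hP
    set x : ℝ := (levelCount N m P : ℝ) with hx
    set y : ℝ := (levelCount N (m + 1) P : ℝ) with hy
    set c : ℝ := (N.card.choose m : ℝ) with hcdef
    set c' : ℝ := (N.card.choose (m + 1) : ℝ)
    have hyx : y / c' ≤ x / c := by
      rw [div_le_div_iff₀ hch' hch]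
      have h0 : 0 < (m : ℝ) + 1 := by positivity
      refine le_of_mul_le_mul_right (a := (m : ℝ) + 1) ?_ h0
      calc y * c * (m + 1) = ((m + 1) * y) * c := by ring
        _ ≤ ((N.card - m) * x) * c := by gcongr
        _ = x * c' * (m + 1) := by rw [mul_assoc x, hcc]; ring
    simp only [seqProb_succ]
    rw [le_div_iff₀ hc, ← sum_add_sum_compl N]
    have hA : ∑ a ∈ N, (levelCount N m (fun T => P (insert a T)) : ℝ) / c ≤
        ∑ a ∈ N, seqProb m (fun T => P (insert a T)) := by
      refine sum_le_sum fun a _ => ih hm' _ ?_ ?_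
      · intro b T h; rw [insert_comm] at h; exact hP _ _ h
      · intro b hb T h; rw [insert_comm]; exact hN b hb _ h
    have hB : ∑ _a ∈ Nᶜ, y / c' ≤ ∑ a ∈ Nᶜ, seqProb m (fun T => P (insert a T)) := by
      refine sum_le_sum fun a ha => hyx.trans ((ih hm' P hP hN).trans ?_)
      exact seqProb_mono m fun T => hN a (mem_compl.1 ha) T
    have hA' : (N.card : ℝ) * (y / c') ≤
        ∑ a ∈ N, (levelCount N m (fun T => P (insert a T)) : ℝ) / c := by
      rw [← sum_div, ← Nat.cast_sum, sum_levelCount_insert]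
      push_cast
      rw [← hx, ← hy]
      have h1 : y / c' * ((N.card : ℝ) - m) = (m + 1) * y / c := by
        field_simp
        linear_combination (-y) * hcc
      have h2 : (m : ℝ) * (y / c') ≤ m * x / c := by
        rw [mul_div_assoc]; gcongr
      rw [add_div]
      linarith
    rw [sum_const, card_compl, nsmul_eq_mul, Nat.cast_sub (card_le_univ N)] at hB
    linarith

end Comparison

/-! ### Cycle covers without short cycles -/

section CycleCover

open Equiv Equiv.Perm

variable {V : Type*} [DecidableEq V]

/-- Any two sets of at least `b` vertices are joined by an arc from the first to the second. -/
def SetsJoined (D : Digraph V) (b : ℕ) : Prop :=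
  ∀ S T : Finset V, b ≤ S.card → b ≤ T.card → ∃ s ∈ S, ∃ t ∈ T, D.Adj s t

/-- The permutation `σ` maps every vertex to one of its out-neighbours, so that its cycles are
vertex-disjoint directed cycles of `D` (possibly loops) which cover all the vertices. -/
def IsCycleCover (D : Digraph V) (σ : Perm V) : Prop :=
  ∀ v, D.Adj v (σ v)

theorem exists_isCycleCover [Fintype V] {D : Digraph V} {b k : ℕ} (hD : SetsJoined D b)
    (hout : ∀ v, k ≤ outDeg D v) (hin : ∀ v, k ≤ inDeg D v) (hb : b ≤ k) :
    ∃ σ, IsCycleCover D σ := by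
  classical
  have hall : ∀ S : Finset V, S.card ≤ (S.biUnion fun v => univ.filter fun w => D.Adj v w).card := by
    intro S
    by_contra! h
    set N := S.biUnion fun v => univ.filter fun w => D.Adj v w with hN
    have hSne : S.Nonempty := card_pos.1 (by omega)
    obtain ⟨v, hv⟩ := hSne
    have hNk : k ≤ N.card := (hout v).trans (card_le_card fun w hw => mem_biUnion.2 ⟨v, hv, hw⟩)
    have hno : ∀ s ∈ S, ∀ t ∈ Nᶜ, ¬ D.Adj s t := by
      intro s hs t ht hst
      exact mem_compl.1 ht (mem_biUnion.2 ⟨s, hs, by simpa using hst⟩)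
    have hNc : Nᶜ.card < b := by
      by_contra! hle
      obtain ⟨s, hs, t, ht, hst⟩ := hD S Nᶜ (by omega) hle
      exact hno s hs t ht hst
    have hlt : N.card < Fintype.card V := h.trans_le (card_le_univ S)
    obtain ⟨t, ht⟩ : Nᶜ.Nonempty := card_pos.1 (by rw [card_compl]; omega)
    have hSc : k ≤ Sᶜ.card := (hin t).trans (card_le_card fun w hw => by
      rw [mem_compl]; intro hwS; exact hno w hwS t ht (by simpa using hw))
    rw [card_compl] at hSc hNc
    omega
  obtain ⟨f, hf, hadj⟩ := (all_card_le_biUnion_card_iff_exists_injective _).1 hall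
  exact ⟨Equiv.ofBijective f (Finite.injective_iff_bijective.1 hf), fun v => by simpa using hadj v⟩

/-- If the cycles of `σ` are laid out one after the other, then an initial segment `I` of the
resulting line is left by at most one arc of `σ`; it can be chosen to contain any prescribed number
of elements of `A`. -/
theorem exists_card_inter_eq [Fintype V] (σ : Perm V) (A : Finset V) {h : ℕ} (hh : h ≤ A.card) :
    ∃ I : Finset V, (A ∩ I).card = h ∧ (I.image σ \ I).card ≤ 1 := by
  obtain ⟨I, hI, hmax⟩ := exists_max_image
    (univ.filter fun I : Finset V => (A ∩ I).card ≤ h ∧ (I.image σ \ I).card ≤ 1) card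
    ⟨∅, by simp⟩
  simp only [mem_filter, mem_univ, true_and] at hI hmax
  refine ⟨I, le_antisymm hI.1 ?_, hI.2⟩
  by_contra! hlt
  obtain ⟨w, hw, hIw⟩ : ∃ w, w ∉ I ∧ I.image σ \ I ⊆ {w} := by
    rcases (I.image σ \ I).eq_empty_or_nonempty with he | ⟨w, hw⟩
    · have : ∃ w ∈ A, w ∉ I := by
        by_contra! hAI
        rw [inter_eq_left.2 hAI] at hlt
        omega
      obtain ⟨w, -, hw⟩ := this
      exact ⟨w, hw, by simp [he]⟩
    · exact ⟨w, (Finset.mem_sdiff.1 hw).2, fun y hy =>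
        mem_singleton.2 (card_le_one.1 hI.2 _ hy _ hw)⟩
  have hle := hmax (insert w I) ⟨?_, ?_⟩
  · rw [card_insert_of_notMem hw] at hle; omega
  · have : A ∩ insert w I ⊆ insert w (A ∩ I) := fun y hy => by
      simp only [mem_inter, mem_insert] at hy ⊢; tauto
    exact (card_le_card this).trans ((card_insert_le _ _).trans hlt)
  · have : (insert w I).image σ \ insert w I ⊆ {σ w} := by
      intro y hy
      simp only [image_insert, Finset.mem_sdiff, mem_insert, not_or] at hy
      rcases hy.1 with rfl | hy1
      · simp
      · exact absurd (mem_singleton.1 (hIw (Finset.mem_sdiff.2 ⟨hy1, hy.2.2⟩))) hy.2.1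
    exact (card_le_card this).trans (by simp)

/-- Two large sets have large parts that are separated by a set which is entered by at most one arc
of `σ`. -/
theorem exists_separation [Fintype V] (σ : Perm V) (A X : Finset V) {h : ℕ} (hA : 2 * h ≤ A.card)
    (hX : 2 * h ≤ X.card) :
    ∃ J : Finset V, h ≤ (A ∩ J).card ∧ h ≤ (X \ J).card ∧ (J \ J.image σ).card ≤ 1 := by
  obtain ⟨I, hI, hI1⟩ := exists_card_inter_eq σ A (h := h) (by omega)
  have hAI := card_sdiff_add_card_inter A I
  have hXI := card_sdiff_add_card_inter X I
  by_cases hc : h ≤ (X \ I).card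
  · refine ⟨I, hI.ge, hc, ?_⟩
    rwa [card_sdiff_comm (card_image_of_injective I σ.injective).symm]
  · refine ⟨Iᶜ, ?_, ?_, ?_⟩
    · rw [← sdiff_eq_inter_compl]; omega
    · rw [sdiff_compl]; exact (by omega : h ≤ (X ∩ I).card)
    · refine le_trans (card_le_card ?_) hI1
      intro y hy
      simp only [Finset.mem_sdiff, mem_compl, mem_image, not_exists, not_and] at hy ⊢
      refine ⟨?_, hy.1⟩
      by_contra hne
      exact hy.2 (σ.symm y) (fun hin => hne ⟨_, hin, by simp⟩) (by simp)

/-- A trajectory of `σ` which starts outside `J` and is inside `J` after `j` steps has passed an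
entry point of `J` less than `j` steps before. -/
theorem exists_entry {σ : Perm V} {J : Finset V} {x : V} (hx : x ∉ J) (j : ℕ)
    (hj : (σ ^ j) x ∈ J) : ∃ i < j, ∃ e ∈ J \ J.image σ, (σ ^ j) x = (σ ^ i) e := by
  induction j with
  | zero => exact absurd hj hx
  | succ j ih =>
    by_cases h : (σ ^ j) x ∈ J
    · obtain ⟨i, hi, e, he, h⟩ := ih h
      exact ⟨i + 1, by omega, e, he, by rw [pow_succ', pow_succ', mul_apply, mul_apply, h]⟩
    · refine ⟨0, by omega, _, Finset.mem_sdiff.2 ⟨hj, ?_⟩, rfl⟩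
      rw [pow_succ', mul_apply]
      intro hm
      obtain ⟨y, hy, hyx⟩ := mem_image.1 hm
      exact h (σ.injective hyx ▸ hy)

/-- The permutation which differs from `σ` in that `v`, `a`, `x` take over the images of `a`, `x`,
`v`, respectively. -/
def rotate3 (σ : Perm V) (v a x : V) : Perm V :=
  σ * (swap v a * swap a x)

section Rotate

variable {σ : Perm V} {v a x : V}

theorem rotate3_first (hva : v ≠ a) (hvx : v ≠ x) : rotate3 σ v a x v = σ a := by
  simp [rotate3, swap_apply_of_ne_of_ne hva hvx]

theorem rotate3_second (hvx : v ≠ x) (hax : a ≠ x) : rotate3 σ v a x a = σ x := by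
  simp [rotate3, swap_apply_of_ne_of_ne hvx.symm hax.symm]

theorem rotate3_third : rotate3 σ v a x x = σ v := by
  simp [rotate3]

theorem rotate3_of_ne {u : V} (hv : u ≠ v) (ha : u ≠ a) (hx : u ≠ x) :
    rotate3 σ v a x u = σ u := by
  simp [rotate3, swap_apply_of_ne_of_ne ha hx, swap_apply_of_ne_of_ne hv ha]

/-- If `v` lies on a cycle of `σ` of the minimal length `s`, and neither `a` nor `x` does, and the
trajectory of `x` does not reach `a` within `s` steps, then `rotate3 σ v a x` creates no cycle of
length at most `s`, and destroys that of `v`. -/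
theorem rotate3_pow_ne {s : ℕ} (hmin : ∀ u, ∀ j, 1 ≤ j → j < s → (σ ^ j) u ≠ u)
    (hv : (σ ^ s) v = v) (hva : ¬ SameCycle σ v a) (hvx : ¬ SameCycle σ v x) (hax : a ≠ x)
    (hxa : ∀ j, 1 ≤ j → j ≤ s → (σ ^ j) x ≠ a) :
    (∀ j, 1 ≤ j → j ≤ s → (rotate3 σ v a x ^ j) v ≠ v) ∧
    ∀ u, ∀ j, 1 ≤ j → j ≤ s → (rotate3 σ v a x ^ j) u = u → (σ ^ j) u = u := by
  have hva' : v ≠ a := fun h => hva (h ▸ SameCycle.refl _ _)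
  have hvx' : v ≠ x := fun h => hvx (h ▸ SameCycle.refl _ _)
  set ρ := rotate3 σ v a x with hρ
  have hx' : ∀ j, 1 ≤ j → j ≤ s → (ρ ^ j) x = (σ ^ j) v := by
    intro j hj1 hjs
    induction j, hj1 using Nat.le_induction with
    | base => simpa using rotate3_third
    | succ j hj1 ih =>
      rw [pow_succ', pow_succ', mul_apply, mul_apply, ih (by omega)]
      refine rotate3_of_ne (hmin v j hj1 (by omega)) ?_ ?_
      · intro h; exact hva ⟨j, by simpa using h⟩
      · intro h; exact hvx ⟨j, by simpa using h⟩
  have ha' : ∀ j, 1 ≤ j → j ≤ s → (ρ ^ j) a = (σ ^ j) x := by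
    intro j hj1 hjs
    induction j, hj1 using Nat.le_induction with
    | base => simpa using rotate3_second hvx' hax
    | succ j hj1 ih =>
      rw [pow_succ', pow_succ', mul_apply, mul_apply, ih (by omega)]
      refine rotate3_of_ne ?_ (hxa j hj1 (by omega)) (hmin x j hj1 (by omega))
      intro h; exact hvx (SameCycle.symm ⟨j, by simpa using h⟩)
  have Fv : ∀ j, 1 ≤ j → j ≤ s → (ρ ^ j) v ≠ v := by
    intro j hj1 hjs hjv
    have h1 : (ρ ^ s) x = v := by rw [hx' s (by omega) le_rfl, hv]
    have h2 : (ρ ^ (s - j)) x = v := by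
      apply (ρ ^ j).injective
      rw [← mul_apply, ← pow_add, hjv, show j + (s - j) = s by omega, h1]
    rcases Nat.eq_zero_or_pos (s - j) with h0 | hpos
    · rw [h0] at h2; exact hvx' h2.symm
    · rw [hx' _ hpos (by omega)] at h2
      exact hmin v _ hpos (by omega) h2
  have Fx : ∀ j, 1 ≤ j → j ≤ s → (ρ ^ j) x ≠ x := by
    intro j hj1 hjs hjx
    rw [hx' j hj1 hjs] at hjx
    exact hvx ⟨j, by simpa using hjx⟩
  have Fa : ∀ j, 1 ≤ j → j ≤ s → (ρ ^ j) a ≠ a := by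
    intro j hj1 hjs hja
    rw [ha' j hj1 hjs] at hja
    exact hxa j hj1 hjs hja
  refine ⟨Fv, fun u j hj1 hjs hju => ?_⟩
  have avoid : ∀ w, (ρ ^ j) w ≠ w → ∀ i : ℕ, (ρ ^ i) u ≠ w := by
    rintro w hw i rfl
    apply hw
    rw [← mul_apply, ← pow_add, add_comm, pow_add, mul_apply, hju]
  have agree : ∀ i : ℕ, (ρ ^ i) u = (σ ^ i) u := by
    intro i
    induction i with
    | zero => rfl
    | succ i ih =>
      rw [pow_succ', pow_succ', mul_apply, mul_apply, ← ih]
      exact rotate3_of_ne (avoid v (Fv j hj1 hjs) i) (avoid a (Fa j hj1 hjs) i)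
        (avoid x (Fx j hj1 hjs) i)
  rw [← agree, hju]

end Rotate

theorem card_sameCycle_le [Fintype V] {σ : Perm V} {v : V} {s : ℕ} (hs : 1 ≤ s)
    (hv : (σ ^ s) v = v) :
    (univ.filter fun w => SameCycle σ v w).card ≤ s := by
  have : (univ.filter fun w => SameCycle σ v w) ⊆ (range s).image fun i => (σ ^ i) v := by
    intro w hw
    obtain ⟨i, hi⟩ := (mem_filter.1 hw).2.exists_nat_pow_eq
    refine mem_image.2 ⟨i % s, mem_range.2 (Nat.mod_lt _ hs), ?_⟩
    rw [← hi]
    conv_rhs => rw [← Nat.mod_add_div i s, pow_add, pow_mul, mul_apply,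
      pow_apply_eq_self_of_apply_eq_self hv]
  exact (card_le_card this).trans (card_image_le.trans (by simp))

open scoped Classical in
theorem card_filter_adj_apply [Fintype V] (D : Digraph V) (σ : Perm V) (v : V) :
    (univ.filter fun a => D.Adj v (σ a)).card = outDeg D v := by
  unfold outDeg
  rw [← card_image_of_injective _ σ.injective]
  congr 1
  ext w
  simp only [mem_image, mem_filter, mem_univ, true_and]
  exact ⟨by rintro ⟨a, h, rfl⟩; exact h, fun h => ⟨σ.symm w, by simpa using h, by simp⟩⟩

/-- In a digraph with large minimum degrees in which large sets are joined, a short cycle of a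
cycle cover can be spliced into other cycles, with a long way from `x` to `a`. -/
theorem exists_rotate3 [Fintype V] {D : Digraph V} {b k s : ℕ} (hD : SetsJoined D b)
    (hout : ∀ v, k ≤ outDeg D v) (hin : ∀ v, k ≤ inDeg D v) (hs : 1 ≤ s) (hk : 2 * b + 3 * s ≤ k)
    {σ : Perm V} (hσ : IsCycleCover D σ) {v : V} (hv : (σ ^ s) v = v) :
    ∃ a x, IsCycleCover D (rotate3 σ v a x) ∧ ¬ SameCycle σ v a ∧ ¬ SameCycle σ v x ∧ a ≠ x ∧
      ∀ j, 1 ≤ j → j ≤ s → (σ ^ j) x ≠ a := by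
  classical
  set C := univ.filter fun w => SameCycle σ v w with hC
  have hCs : C.card ≤ s := card_sameCycle_le hs hv
  set A := (univ.filter fun a => D.Adj v (σ a)) \ C with hA
  set X := (univ.filter fun x => D.Adj x (σ v)) \ C with hX
  have hAc : 2 * (b + s) ≤ A.card := by
    have h1 := card_filter_adj_apply D σ v
    have h2 : (univ.filter fun a => D.Adj v (σ a)).card - C.card ≤ A.card := le_card_sdiff C _
    have := hout v
    omega
  have hXc : 2 * (b + s) ≤ X.card := by
    have h1 : (univ.filter fun x => D.Adj x (σ v)).card = inDeg D (σ v) := by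
      unfold inDeg; congr
    have h2 : (univ.filter fun x => D.Adj x (σ v)).card - C.card ≤ X.card := le_card_sdiff C _
    have := hin (σ v)
    omega
  obtain ⟨J, hJA, hJX, hJ⟩ := exists_separation σ A X hAc hXc
  -- the first `s` vertices after the entry into `J`
  set F := (range s).biUnion fun i => (J \ J.image σ).image (σ ^ i) with hF
  have hFc : F.card ≤ s := by
    refine card_biUnion_le.trans ?_
    calc _ ≤ ∑ _i ∈ range s, 1 := sum_le_sum fun i _ => card_image_le.trans hJ
      _ = s := by simp
  have hS : b ≤ ((A ∩ J) \ F).card := by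
    have := le_card_sdiff F (A ∩ J)
    omega
  have hT : b ≤ ((X \ J).image σ).card := by
    rw [card_image_of_injective _ σ.injective]; omega
  obtain ⟨a, ha, t, ht, hat⟩ := hD _ _ hS hT
  obtain ⟨x, hx, rfl⟩ := mem_image.1 ht
  simp only [Finset.mem_sdiff, mem_inter, hA, hX, hC, mem_filter, mem_univ, true_and] at ha hx
  obtain ⟨⟨⟨hvaD, hva⟩, haJ⟩, haF⟩ := ha
  obtain ⟨⟨hxvD, hvx⟩, hxJ⟩ := hx
  have hax : a ≠ x := fun h => hxJ (h ▸ haJ)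
  have hva' : v ≠ a := fun h => hva (h ▸ SameCycle.refl _ _)
  have hvx' : v ≠ x := fun h => hvx (h ▸ SameCycle.refl _ _)
  refine ⟨a, x, ?_, hva, hvx, hax, ?_⟩
  · intro u
    by_cases h1 : u = v
    · subst h1; rw [rotate3_first hva' hvx']; exact hvaD
    by_cases h2 : u = a
    · subst h2; rw [rotate3_second hvx' hax]; exact hat
    by_cases h3 : u = x
    · subst h3; rw [rotate3_third]; exact hxvD
    rw [rotate3_of_ne h1 h2 h3]; exact hσ u
  · rintro j hj1 hjs rfl
    obtain ⟨i, hi, e, he, hie⟩ := exists_entry hxJ j haJ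
    exact haF (mem_biUnion.2 ⟨i, mem_range.2 (by omega), mem_image.2 ⟨e, he, hie.symm⟩⟩)

theorem exists_isCycleCover_of_joined [Fintype V] {D : Digraph V} {b k L : ℕ} (hD : SetsJoined D b)
    (hout : ∀ v, k ≤ outDeg D v) (hin : ∀ v, k ≤ inDeg D v) (hk : 2 * b + 3 * L ≤ k) :
    ∃ σ, IsCycleCover D σ ∧ ∀ u, ∀ j, 1 ≤ j → j ≤ L → (σ ^ j) u ≠ u := by
  classical
  induction L with
  | zero =>
    obtain ⟨σ, hσ⟩ := exists_isCycleCover hD hout hin (by omega)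
    exact ⟨σ, hσ, fun u j h1 h2 => by omega⟩
  | succ L ih =>
    obtain ⟨σ₀, hσ₀⟩ := ih (by omega)
    obtain ⟨σ, hσ, hmin⟩ := exists_min_image
      (univ.filter fun σ : Perm V => IsCycleCover D σ ∧ ∀ u, ∀ j, 1 ≤ j → j ≤ L → (σ ^ j) u ≠ u)
      (fun σ => (univ.filter fun u => (σ ^ (L + 1)) u = u).card) ⟨σ₀, by simpa using hσ₀⟩
    simp only [mem_filter, mem_univ, true_and] at hσ hmin
    refine ⟨σ, hσ.1, fun v j hj1 hjL hv => ?_⟩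
    obtain rfl : j = L + 1 := by
      by_contra hne
      exact hσ.2 v j hj1 (by omega) hv
    obtain ⟨a, x, hcov, hva, hvx, hax, hxa⟩ := exists_rotate3 hD hout hin hj1 hk hσ.1 hv
    obtain ⟨h1, h2⟩ := rotate3_pow_ne (fun u j hj1 hj => hσ.2 u j hj1 (by omega)) hv hva hvx hax hxa
    have := hmin (rotate3 σ v a x) ⟨hcov, fun u j hj1 hjL h =>
      hσ.2 u j hj1 hjL (h2 u j hj1 (by omega) h)⟩
    refine absurd this (not_le.2 (card_lt_card ?_))
    refine ⟨fun u hu => ?_, fun hsub => ?_⟩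
    · simp only [mem_filter, mem_univ, true_and] at hu ⊢
      exact h2 u _ hj1 le_rfl hu
    · have : v ∈ univ.filter fun u => (σ ^ (L + 1)) u = u := by simpa using hv
      exact h1 _ hj1 le_rfl (by simpa using hsub this)

end CycleCover

/-! ### Arcs between large sets -/

section RandomArcs

variable {V : Type*} [Fintype V] [DecidableEq V] [Nonempty V]

theorem seqProb_not_setsJoined_le (H : Digraph V) (m b : ℕ) :
    seqProb m (fun T => ¬ SetsJoined (addArcs H T) b) ≤
      (Fintype.card V).choose b ^ 2 * Real.exp (-(m * b ^ 2 / Fintype.card V ^ 2)) := by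
  set B := (univ : Finset V).powersetCard b with hB
  calc seqProb m (fun T => ¬ SetsJoined (addArcs H T) b)
      ≤ seqProb m (fun T => ∃ p ∈ B ×ˢ B, Disjoint T (p.1 ×ˢ p.2)) := by
        refine seqProb_mono m fun T hT => ?_
        unfold SetsJoined at hT
        push Not at hT
        obtain ⟨S, U, hS, hU, h⟩ := hT
        obtain ⟨S', hS', hSb⟩ := exists_subset_card_eq hS
        obtain ⟨U', hU', hUb⟩ := exists_subset_card_eq hU
        refine ⟨(S', U'), by simp [hB, hSb, hUb], ?_⟩
        rw [disjoint_left]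
        rintro ⟨s, u⟩ hT hsu
        rw [mem_product] at hsu
        exact h s (hS' hsu.1) u (hU' hsu.2) (Or.inr hT)
    _ ≤ ∑ p ∈ B ×ˢ B, seqProb m (fun T => Disjoint T (p.1 ×ˢ p.2)) := seqProb_exists _ _ _
    _ ≤ ∑ _p ∈ B ×ˢ B, Real.exp (-(m * b ^ 2 / Fintype.card V ^ 2)) := by
        refine sum_le_sum fun p hp => (seqProb_disjoint_le m _).trans (le_of_eq ?_)
        simp only [hB, mem_product, mem_powersetCard] at hp
        rw [card_product, hp.1.2, hp.2.2, Fintype.card_prod]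
        push_cast
        ring_nf
    _ = _ := by
        rw [sum_const, card_product, hB, card_powersetCard, card_univ, nsmul_eq_mul]
        push_cast
        ring

/-- Few values of a random sequence of pairs lead out of only a few vertices: a union bound over the
sets of `M` vertices which could contain the tails of all the sampled pairs from `E`. -/
theorem seqProb_card_tails_lt_le (m : ℕ) (E : Finset (V × V)) {M d : ℕ} (hM : M ≤ Fintype.card V)
    (hE : ∀ v, (E.filter fun p => p.1 = v).card ≤ d) :
    seqProb m (fun T => ((T ∩ E).image Prod.fst).card < M) ≤
      (Fintype.card V : ℝ) ^ M * Real.exp (-(m * (E.card - M * d) / Fintype.card V ^ 2)) := by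
  set B := (univ : Finset V).powersetCard M with hB
  calc seqProb m (fun T => ((T ∩ E).image Prod.fst).card < M)
      ≤ seqProb m (fun T => ∃ U ∈ B, Disjoint T (E.filter fun p => p.1 ∉ U)) := by
        refine seqProb_mono m fun T hT => ?_
        obtain ⟨U, hTU, -, hU⟩ := exists_subsuperset_card_eq (subset_univ _) hT.le
          (by rwa [card_univ])
        refine ⟨U, by simp [hB, hU], ?_⟩
        rw [disjoint_left]
        intro p hp hpE
        rw [mem_filter] at hpE
        exact hpE.2 (hTU (mem_image_of_mem _ (mem_inter.2 ⟨hp, hpE.1⟩)))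
    _ ≤ ∑ U ∈ B, seqProb m (fun T => Disjoint T (E.filter fun p => p.1 ∉ U)) :=
        seqProb_exists _ _ _
    _ ≤ ∑ _U ∈ B, Real.exp (-(m * (E.card - M * d) / Fintype.card V ^ 2)) := by
        refine sum_le_sum fun U hU => (seqProb_disjoint_le m _).trans ?_
        simp only [hB, mem_powersetCard] at hU
        have h1 := card_filter_add_card_filter_not (s := E) (fun p => p.1 ∈ U)
        have h2 : (E.filter fun p => p.1 ∈ U).card ≤ M * d := by
          rw [← hU.2, ← smul_eq_mul, ← sum_const]
          have hmaps : Set.MapsTo Prod.fst (E.filter fun p => p.1 ∈ U : Set (V × V)) (U : Set V) :=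
            fun p hp => (mem_filter.1 hp).2
          rw [card_eq_sum_card_fiberwise hmaps]
          refine sum_le_sum fun v _ => le_trans (card_le_card fun p hp => ?_) (hE v)
          simp only [mem_filter] at hp ⊢
          exact ⟨hp.1.1, hp.2⟩
        have h3 : (E.card : ℝ) - M * d ≤ (E.filter fun p => p.1 ∉ U).card := by
          have h4 : (E.card : ℝ) = (E.filter fun p => p.1 ∈ U).card +
            (E.filter fun p => p.1 ∉ U).card := by exact_mod_cast h1.symm
          have h5 : ((E.filter fun p => p.1 ∈ U).card : ℝ) ≤ M * d := by exact_mod_cast h2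
          linarith
        rw [Fintype.card_prod, Nat.cast_mul, ← sq]
        gcongr
    _ ≤ _ := by
        rw [sum_const, hB, card_powersetCard, card_univ, nsmul_eq_mul]
        gcongr
        exact_mod_cast Nat.choose_le_pow _ _

end RandomArcs

theorem choose_le_exp {n b : ℕ} (hb : 0 < b) (hn : 0 < n) :
    (n.choose b : ℝ) ≤ Real.exp (b * (1 + Real.log (n / b))) := by
  have hb' : (0 : ℝ) < b := by exact_mod_cast hb
  have hn' : (0 : ℝ) < n := by exact_mod_cast hn
  have h1 := Nat.choose_le_pow_div (α := ℝ) b n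
  have h2 := Real.pow_div_factorial_le_exp (b : ℝ) hb'.le b
  rw [mul_add, mul_one, Real.exp_add, Real.exp_nat_mul, Real.exp_log (by positivity)]
  calc (n.choose b : ℝ) ≤ (n : ℝ) ^ b / b.factorial := h1
    _ = (b : ℝ) ^ b / b.factorial * ((n : ℝ) / b) ^ b := by
        rw [div_pow]; field_simp
    _ ≤ _ := by gcongr

/-- If `2 (1 + log (1 / β)) < c β`, then `c n` random arcs almost surely join all pairs of sets of
size `β n`. -/
theorem eventually_seqProb_not_setsJoined_le {β c : ℝ} (hβ : 0 < β)
    (hc : 2 * (1 + Real.log β⁻¹) < c * β) {ε : ℝ} (hε : 0 < ε) :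
    ∀ᶠ n : ℕ in atTop, ∀ H : Digraph (Fin n), ∀ m : ℕ, c * n ≤ m →
      seqProb m (fun T => ¬ SetsJoined (addArcs H T) ⌈β * n⌉₊) ≤ ε := by
  set κ := c * β - 2 * (1 + Real.log β⁻¹) with hκ
  have hκ0 : 0 < κ := by linarith
  have hlim : Tendsto (fun n : ℕ => Real.exp (-(κ * β * n))) atTop (nhds 0) := by
    refine Real.tendsto_exp_neg_atTop_nhds_zero.comp ?_
    exact Tendsto.const_mul_atTop (by positivity) tendsto_natCast_atTop_atTop
  filter_upwards [hlim.eventually_le_const hε, eventually_gt_atTop 0] with n hn hn0 H m hm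
  have hn' : (0 : ℝ) < n := by exact_mod_cast hn0
  have : Nonempty (Fin n) := ⟨⟨0, hn0⟩⟩
  set b := ⌈β * n⌉₊ with hb
  have hbn : β * n ≤ b := Nat.le_ceil _
  have hb0 : (0 : ℝ) < b := lt_of_lt_of_le (by positivity) hbn
  have hlog : Real.log (n / b) ≤ Real.log β⁻¹ := by
    apply Real.log_le_log (by positivity)
    rw [inv_eq_one_div, div_le_div_iff₀ hb0 hβ]
    linarith
  refine (seqProb_not_setsJoined_le H m b).trans (le_trans ?_ hn)
  rw [Fintype.card_fin]
  calc ((n.choose b : ℝ)) ^ 2 * Real.exp (-(m * b ^ 2 / n ^ 2))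
      ≤ Real.exp (b * (1 + Real.log (n / b))) ^ 2 * Real.exp (-(m * b ^ 2 / n ^ 2)) := by
        gcongr
        exact choose_le_exp (by exact_mod_cast hb0) hn0
    _ = Real.exp (2 * (b * (1 + Real.log (n / b))) - m * b ^ 2 / n ^ 2) := by
        rw [← Real.exp_nat_mul, ← Real.exp_add]; push_cast; ring_nf
    _ ≤ Real.exp (-(κ * β * n)) := by
        apply Real.exp_le_exp.2
        have h1 : b * (c * β) ≤ m * b ^ 2 / n ^ 2 := by
          rw [le_div_iff₀ (by positivity)]
          have hc0 : 0 ≤ c ∨ c < 0 := le_or_gt 0 c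
          rcases hc0 with hc0 | hc0
          · calc b * (c * β) * n ^ 2 = b * ((c * n) * (β * n)) := by ring
              _ ≤ b * (m * b) := by gcongr
              _ = _ := by ring
          · have : b * (c * β) * (n : ℝ) ^ 2 ≤ 0 := by
              have : c * β ≤ 0 := by nlinarith
              have : b * (c * β) ≤ 0 := by nlinarith
              nlinarith [sq_nonneg (n : ℝ)]
            exact this.trans (by positivity)
        have h2 : b * (1 + Real.log (n / b)) ≤ b * (1 + Real.log β⁻¹) := by gcongr
        have h3 : κ * (β * n) ≤ κ * b := by gcongr
        rw [hκ] at h3 ⊢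
        nlinarith

/-! ### Merging long cycles -/

section Merging

open Equiv Equiv.Perm

variable {V : Type*}

theorem IsCycleCover.addArcs {D : Digraph V} {σ : Perm V} (h : IsCycleCover D σ)
    (T : Finset (V × V)) : IsCycleCover (addArcs D T) σ :=
  fun v => Or.inl (h v)

theorem exists_minimal_period [Finite V] (σ : Perm V) (v : V) :
    ∃ l, 1 ≤ l ∧ (σ ^ l) v = v ∧ ∀ t, 1 ≤ t → t < l → (σ ^ t) v ≠ v := by
  classical
  have h : ∃ l, 1 ≤ l ∧ (σ ^ l) v = v :=
    ⟨orderOf σ, orderOf_pos σ, by rw [pow_orderOf_eq_one]; rfl⟩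
  refine ⟨Nat.find h, (Nat.find_spec h).1, (Nat.find_spec h).2, fun t ht1 ht htv => ?_⟩
  exact Nat.find_min h ht ⟨ht1, htv⟩

theorem pow_apply_mod {σ : Perm V} {v : V} {l : ℕ} (hl : (σ ^ l) v = v) (i : ℕ) :
    (σ ^ (i % l)) v = (σ ^ i) v := by
  conv_rhs => rw [← Nat.mod_add_div i l, pow_add, pow_mul, mul_apply,
    pow_apply_eq_self_of_apply_eq_self hl]

theorem exists_lt_of_sameCycle [Finite V] {σ : Perm V} {v w : V} {l : ℕ} (hl : 1 ≤ l)
    (hlv : (σ ^ l) v = v) (h : SameCycle σ v w) : ∃ i < l, (σ ^ i) v = w := by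
  obtain ⟨i, hi⟩ := h.exists_nat_pow_eq
  exact ⟨i % l, Nat.mod_lt _ hl, by rw [pow_apply_mod hlv, hi]⟩

theorem eq_of_pow_apply_eq {σ : Perm V} {v : V} {l i j : ℕ}
    (hmin : ∀ t, 1 ≤ t → t < l → (σ ^ t) v ≠ v) (hi : i < l) (hj : j < l)
    (h : (σ ^ i) v = (σ ^ j) v) : i = j := by
  wlog hij : i ≤ j generalizing i j
  · exact (this hj hi h.symm (by omega)).symm
  by_contra hne
  refine hmin (j - i) (by omega) (by omega) ?_
  apply (σ ^ i).injective
  rw [← mul_apply, ← pow_add, show i + (j - i) = j by omega, h]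

theorem isHamiltonianDigraph_of_sameCycle [Fintype V] {D : Digraph V} {σ : Perm V}
    (hσ : IsCycleCover D σ) (v : V) (h : ∀ w, SameCycle σ v w) : IsHamiltonianDigraph D := by
  classical
  obtain ⟨l, hl1, hlv, hmin⟩ := exists_minimal_period σ v
  have hl : Fintype.card V = l := by
    rw [← card_range l, ← card_univ]
    symm
    refine card_bij (fun i _ => (σ ^ i) v) (fun _ _ => mem_univ _) ?_ ?_
    · intro i hi j hj hij
      exact eq_of_pow_apply_eq hmin (mem_range.1 hi) (mem_range.1 hj) hij
    · intro w _
      obtain ⟨i, hi, hw⟩ := exists_lt_of_sameCycle hl1 hlv (h w)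
      exact ⟨i, mem_range.2 hi, hw⟩
  have hne : NeZero (Fintype.card V) := ⟨by omega⟩
  let f : ZMod (Fintype.card V) → V := fun i => (σ ^ i.val) v
  have hf : Function.Bijective f := by
    rw [Fintype.bijective_iff_surjective_and_card]
    refine ⟨fun w => ?_, ZMod.card _⟩
    obtain ⟨i, hi, hw⟩ := exists_lt_of_sameCycle hl1 hlv (h w)
    exact ⟨i, by simp only [f]; rw [ZMod.val_natCast, Nat.mod_eq_of_lt (by omega), hw]⟩
  refine ⟨Equiv.ofBijective f hf, fun i => ?_⟩
  have hcv : (σ ^ Fintype.card V) v = v := by rw [hl, hlv]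
  have : f (i + 1) = σ (f i) := by
    simp only [f]
    rw [ZMod.val_add, ZMod.val_one_eq_one_mod, Nat.add_mod_mod, pow_apply_mod hcv, pow_succ',
      mul_apply]
  simp only [Equiv.ofBijective_apply, this]
  exact hσ _

/-- If `ρ` agrees with `σ` along the trajectory of `y` under `σ` between the times `1` and `j`, then
`ρ` takes its first point to its last one. -/
theorem sameCycle_of_agree {σ ρ : Perm V} {y : V} {j : ℕ} (hj : 1 ≤ j)
    (h : ∀ t, 1 ≤ t → t < j → ρ ((σ ^ t) y) = σ ((σ ^ t) y)) :
    SameCycle ρ (σ y) ((σ ^ j) y) := by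
  induction j, hj using Nat.le_induction with
  | base => simp [SameCycle.refl]
  | succ j hj ih =>
    have h1 := ih fun t h1 h2 => h t h1 (by omega)
    rw [pow_succ', mul_apply, ← h j hj (by omega)]
    exact h1.trans (sameCycle_apply_right.2 (SameCycle.refl _ _))

theorem sameCycle_mono {σ ρ : Perm V} [Finite V] (h : ∀ u, SameCycle ρ u (σ u)) {u w : V}
    (huw : SameCycle σ u w) : SameCycle ρ u w := by
  obtain ⟨i, rfl⟩ := huw.exists_nat_pow_eq
  induction i with
  | zero => exact SameCycle.refl _ _
  | succ i ih =>
    rw [pow_succ', mul_apply]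
    exact (ih ⟨i, by simp⟩).trans (h _)

variable [DecidableEq V]

theorem merge_swap [Finite V] {D : Digraph V} {σ : Perm V} (hσ : IsCycleCover D σ) {x y : V}
    (hxy : ¬ SameCycle σ x y) (h1 : D.Adj x (σ y)) (h2 : D.Adj y (σ x)) :
    ∃ ρ, IsCycleCover D ρ ∧ (∀ u w, SameCycle σ u w → SameCycle ρ u w) ∧ SameCycle ρ x y := by
  have hne : x ≠ y := fun h => hxy (h ▸ SameCycle.refl _ _)
  have hρx : (σ * swap x y) x = σ y := by simp
  have hρy : (σ * swap x y) y = σ x := by simp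
  have hρ : ∀ u, u ≠ x → u ≠ y → (σ * swap x y) u = σ u := by
    intro u hx hy
    simp [swap_apply_of_ne_of_ne hx hy]
  set ρ := σ * swap x y
  have key : SameCycle ρ x y := by
    obtain ⟨l, hl1, hly, hmin⟩ := exists_minimal_period σ y
    have h := sameCycle_of_agree (ρ := ρ) (σ := σ) (y := y) hl1 fun t ht1 ht => hρ _ (fun h => hxy
      (SameCycle.symm ⟨t, by simpa using h⟩)) (hmin t ht1 ht)
    rw [hly, ← hρx] at h
    exact sameCycle_apply_left.1 h
  refine ⟨ρ, fun u => ?_, fun u w => sameCycle_mono fun u => ?_, key⟩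
  · by_cases hx : u = x
    · rwa [hx, hρx]
    by_cases hy : u = y
    · rwa [hy, hρy]
    rw [hρ u hx hy]; exact hσ u
  · by_cases hx : u = x
    · rw [hx, ← hρy]; exact sameCycle_apply_right.2 key
    by_cases hy : u = y
    · rw [hy, ← hρx]; exact sameCycle_apply_right.2 key.symm
    rw [← hρ u hx hy]; exact sameCycle_apply_right.2 (SameCycle.refl _ _)

/-- Along the cycle of `x` one meets `y` and then `z`, three different vertices, before returning
to `x`. -/
def CyclicOrder (σ : Perm V) (x y z : V) : Prop :=
  ∃ i j, 1 ≤ i ∧ i < j ∧ (∀ t, 1 ≤ t → t ≤ j → (σ ^ t) x ≠ x) ∧ (σ ^ i) x = y ∧ (σ ^ j) x = z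

/-- Replacing the arcs of a cycle cover at `x`, `y`, `z`, in this order on one cycle, and at `w` on
another one, merges the two cycles: the three segments of the first cycle can be traversed in the
opposite cyclic order, with the second cycle inserted between two of them. -/
theorem merge_cycle4 [Finite V] {D : Digraph V} {σ : Perm V} (hσ : IsCycleCover D σ) {x y z w : V}
    (hxyz : CyclicOrder σ x y z) (hxw : ¬ SameCycle σ x w) (h1 : D.Adj x (σ y))
    (h2 : D.Adj y (σ w)) (h3 : D.Adj w (σ z)) (h4 : D.Adj z (σ x)) :
    ∃ ρ, IsCycleCover D ρ ∧ (∀ u w, SameCycle σ u w → SameCycle ρ u w) ∧ SameCycle ρ x w := by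
  obtain ⟨l, hl1, hlx, hmin⟩ := exists_minimal_period σ x
  obtain ⟨i, j, hi1, hij, hj, rfl, rfl⟩ := hxyz
  have hjl : j < l := by
    by_contra! h
    exact hj l hl1 h hlx
  have hinj : ∀ {s t}, s < l → t < l → (σ ^ s) x = (σ ^ t) x → s = t :=
    fun hs ht => eq_of_pow_apply_eq hmin hs ht
  have hw : ∀ t, (σ ^ t) x ≠ w := fun t h => hxw ⟨t, by simpa using h⟩
  set y := (σ ^ i) x with hy
  set z := (σ ^ j) x with hz
  have hxy : x ≠ y := (hj i hi1 hij.le).symm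
  have hxz : x ≠ z := (hj j (by omega) le_rfl).symm
  have hyz : y ≠ z := fun h => by have := hinj (by omega) hjl h; omega
  have hxw' : x ≠ w := hw 0
  have hyw : y ≠ w := hw i
  have hzw : z ≠ w := hw j
  set τ : Perm V := swap x y * swap y w * swap w z with hτ
  have hρx : (σ * τ) x = σ y := by
    simp [hτ, swap_apply_of_ne_of_ne hxw' hxz, swap_apply_of_ne_of_ne hxy hxw']
  have hρy : (σ * τ) y = σ w := by
    simp [hτ, swap_apply_of_ne_of_ne hyw hyz, swap_apply_of_ne_of_ne hxw'.symm hyw.symm]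
  have hρw : (σ * τ) w = σ z := by
    simp [hτ, swap_apply_of_ne_of_ne hyz.symm hzw, swap_apply_of_ne_of_ne hxz.symm hyz.symm]
  have hρz : (σ * τ) z = σ x := by simp [hτ]
  have hρ : ∀ u, u ≠ x → u ≠ y → u ≠ z → u ≠ w → (σ * τ) u = σ u := by
    intro u hx hy hz hw
    simp [hτ, swap_apply_of_ne_of_ne hx hy, swap_apply_of_ne_of_ne hy hw,
      swap_apply_of_ne_of_ne hw hz]
  set ρ := σ * τ
  have hin : ∀ t, t < l → t ≠ 0 → t ≠ i → t ≠ j → ρ ((σ ^ t) x) = σ ((σ ^ t) x) := by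
    intro t ht h0 hti htj
    refine hρ _ (fun h => h0 (hinj ht (by omega) h)) (fun h => hti (hinj ht (by omega) h))
      (fun h => htj (hinj ht hjl h)) (hw t)
  -- the three segments of the cycle of `x`, and the cycle of `w`
  have s1 : SameCycle ρ z y := by
    have h := sameCycle_of_agree (ρ := ρ) (σ := σ) (y := x) hi1 fun t ht1 ht =>
      hin t (by omega) (by omega) (by omega) (by omega)
    rw [← hρz] at h
    exact sameCycle_apply_left.1 h
  have s2 : SameCycle ρ x z := by
    have h := sameCycle_of_agree (ρ := ρ) (σ := σ) (y := y) (j := j - i) (by omega)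
      fun t ht1 ht => by
        have hyt : (σ ^ t) y = (σ ^ (t + i)) x := by rw [hy, pow_add, mul_apply]
        rw [hyt]
        exact hin _ (by omega) (by omega) (by omega) (by omega)
    rw [← hρx, hy, ← mul_apply, ← pow_add, show j - i + i = j by omega] at h
    exact sameCycle_apply_left.1 h
  have s3 : SameCycle ρ w x := by
    have h := sameCycle_of_agree (ρ := ρ) (σ := σ) (y := z) (j := l - j) (by omega)
      fun t ht1 ht => by
        have hzt : (σ ^ t) z = (σ ^ (t + j)) x := by rw [hz, pow_add, mul_apply]
        rw [hzt]
        exact hin _ (by omega) (by omega) (by omega) (by omega)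
    rw [← hρw, hz, ← mul_apply, ← pow_add, show l - j + j = l by omega, hlx] at h
    exact sameCycle_apply_left.1 h
  refine ⟨ρ, fun u => ?_, fun u v => sameCycle_mono fun u => ?_, s3.symm⟩
  · by_cases hx : u = x
    · rwa [hx, hρx]
    by_cases hy : u = y
    · rwa [hy, hρy]
    by_cases hz : u = z
    · rwa [hz, hρz]
    by_cases hw : u = w
    · rwa [hw, hρw]
    rw [hρ u hx hy hz hw]; exact hσ u
  · by_cases hx : u = x
    · rw [hx, ← hρz]; exact sameCycle_apply_right.2 s2
    by_cases hy : u = y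
    · rw [hy, ← hρx]; exact sameCycle_apply_right.2 (s1.symm.trans s2.symm)
    by_cases hz : u = z
    · rw [hz, ← hρw]; exact sameCycle_apply_right.2 (s2.symm.trans s3.symm)
    by_cases hw : u = w
    · rw [hw, ← hρy]; exact sameCycle_apply_right.2 (s3.trans (s2.trans s1))
    rw [← hρ u hx hy hz hw]; exact sameCycle_apply_right.2 (SameCycle.refl _ _)

end Merging

/-! ### Merging cycles with a linear number of random arcs -/

section RandomMerging

open Equiv Equiv.Perm

variable {V : Type*} [DecidableEq V]

/-- The pairs `(y, σ x)` with `x ∈ I` and `y ∈ S x`: the arcs which allow `y` to take over the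
image of `x` under `σ`. -/
def arcsInto (σ : Perm V) (I : Finset V) (S : V → Finset V) : Finset (V × V) :=
  I.biUnion fun x => (S x).image fun y => (y, σ x)

theorem mem_arcsInto {σ : Perm V} {I : Finset V} {S : V → Finset V} {p : V × V} :
    p ∈ arcsInto σ I S ↔ ∃ x ∈ I, p.1 ∈ S x ∧ p.2 = σ x := by
  simp only [arcsInto, mem_biUnion, mem_image]
  constructor
  · rintro ⟨x, hx, y, hy, rfl⟩; exact ⟨x, hx, hy, rfl⟩
  · rintro ⟨x, hx, hy, h⟩; exact ⟨x, hx, _, hy, by rw [← h]⟩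

theorem le_card_arcsInto (σ : Perm V) {I : Finset V} {S : V → Finset V} {q : ℕ}
    (h : ∀ x ∈ I, q ≤ (S x).card) : I.card * q ≤ (arcsInto σ I S).card := by
  unfold arcsInto
  rw [card_biUnion]
  · rw [← smul_eq_mul, ← sum_const]
    refine sum_le_sum fun x hx => ?_
    rw [card_image_of_injective _ (Prod.mk_left_injective _)]
    exact h x hx
  · intro x _ y _ hxy
    rw [Function.onFun, disjoint_left]
    intro p hp hp'
    obtain ⟨_, _, rfl⟩ := mem_image.1 hp
    obtain ⟨_, _, h⟩ := mem_image.1 hp'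
    exact hxy (σ.injective (Prod.ext_iff.1 h).2.symm)

theorem card_filter_arcsInto_le (σ : Perm V) (I : Finset V) (S : V → Finset V) (v : V) :
    ((arcsInto σ I S).filter fun p => p.1 = v).card ≤ I.card := by
  rw [← card_image_of_injective I σ.injective]
  refine card_le_card_of_injOn Prod.snd ?_ ?_
  · intro p hp
    obtain ⟨x, hx, -, h⟩ := mem_arcsInto.1 (mem_filter.1 hp).1
    exact mem_image.2 ⟨x, hx, h.symm⟩
  · intro p hp p' hp' h
    exact Prod.ext ((mem_filter.1 hp).2.trans (mem_filter.1 hp').2.symm) h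

theorem seqProb_card_tails_arcsInto_lt_le [Fintype V] [Nonempty V] (m : ℕ) (σ : Perm V) {I : Finset V}
    {S : V → Finset V} {q M : ℕ} (h : ∀ x ∈ I, q ≤ (S x).card) (hM : M ≤ Fintype.card V) :
    seqProb m (fun T => ((T ∩ arcsInto σ I S).image Prod.fst).card < M) ≤
      (Fintype.card V : ℝ) ^ M *
        Real.exp (-(m * (I.card * ((q : ℝ) - M)) / Fintype.card V ^ 2)) := by
  refine (seqProb_card_tails_lt_le m _ hM (card_filter_arcsInto_le σ I S)).trans ?_
  have : ((I.card * q : ℕ) : ℝ) ≤ (arcsInto σ I S).card := by exact_mod_cast le_card_arcsInto σ h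
  push_cast at this
  gcongr
  linarith

theorem seqProb_disjoint_arcsInto_le [Fintype V] [Nonempty V] (m : ℕ) (σ : Perm V) {I : Finset V}
    {S : V → Finset V} {q : ℕ} (h : ∀ x ∈ I, q ≤ (S x).card) :
    seqProb m (fun T => Disjoint T (arcsInto σ I S)) ≤
      Real.exp (-(m * (I.card * q) / Fintype.card V ^ 2)) := by
  refine (seqProb_disjoint_le m _).trans ?_
  have : ((I.card * q : ℕ) : ℝ) ≤ (arcsInto σ I S).card := by exact_mod_cast le_card_arcsInto σ h
  push_cast at this
  rw [Fintype.card_prod, Nat.cast_mul, ← sq]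
  gcongr

theorem card_filter_rank_lt_le (B : Finset V) {f : V → ℕ} (hf : Set.InjOn f B) (g : ℕ) :
    (B.filter fun z => (B.filter fun y => f y < f z).card < g).card ≤ g := by
  set R := B.filter fun z => (B.filter fun y => f y < f z).card < g with hR
  rcases R.eq_empty_or_nonempty with h | h
  · simp [h]
  obtain ⟨z, hz, hmax⟩ := exists_max_image R f h
  have hsub : R.erase z ⊆ B.filter fun y => f y < f z := by
    intro y hy
    obtain ⟨hyz, hyR⟩ := mem_erase.1 hy
    refine mem_filter.2 ⟨(mem_filter.1 hyR).1, lt_of_le_of_ne (hmax y hyR) fun h => hyz ?_⟩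
    exact hf (mem_filter.1 hyR).1 (mem_filter.1 hz).1 h
  have h1 := card_le_card hsub
  rw [card_erase_of_mem hz] at h1
  have h2 := (mem_filter.1 hz).2
  omega

open scoped Classical in
/-- Among the vertices of a set `B` on the cycle of `x`, all but `g` are preceded, on the way from
`x`, by `g` other vertices of `B`. -/
theorem card_le_card_cyclicOrder_add [Fintype V] {σ : Perm V} {x : V} {B : Finset V}
    (hB : ∀ y ∈ B, SameCycle σ x y ∧ y ≠ x) (g : ℕ) :
    B.card ≤ (univ.filter fun z => g ≤ (B.filter fun y => CyclicOrder σ x y z).card).card + g := by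
  obtain ⟨l, hl1, hlx, hmin⟩ := exists_minimal_period σ x
  have hex : ∀ y, ∃ i, y ∈ B → i < l ∧ (σ ^ i) x = y := by
    intro y
    by_cases hy : y ∈ B
    · obtain ⟨i, hi⟩ := exists_lt_of_sameCycle hl1 hlx (hB y hy).1
      exact ⟨i, fun _ => hi⟩
    · exact ⟨0, fun h => absurd h hy⟩
  choose f hf using hex
  have hinj : Set.InjOn f B := by
    intro y hy z hz h
    rw [← (hf y hy).2, ← (hf z hz).2, h]
  have h1 := card_filter_rank_lt_le B hinj g
  have h2 := card_filter_add_card_filter_not (s := B)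
    (fun z => (B.filter fun y => f y < f z).card < g)
  have h3 : (B.filter fun z => ¬ (B.filter fun y => f y < f z).card < g).card ≤
      (univ.filter fun z => g ≤ (B.filter fun y => CyclicOrder σ x y z).card).card := by
    refine card_le_card fun z hz => ?_
    obtain ⟨hzB, hz⟩ := mem_filter.1 hz
    refine mem_filter.2 ⟨mem_univ _, (not_lt.1 hz).trans (card_le_card fun y hy => ?_)⟩
    obtain ⟨hyB, hyz⟩ := mem_filter.1 hy
    refine mem_filter.2 ⟨hyB, f y, f z, ?_, hyz, ?_, (hf y hyB).2, (hf z hzB).2⟩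
    · by_contra h0
      have := (hf y hyB).2
      rw [show f y = 0 by omega] at this
      exact (hB y hyB).2 this.symm
    · intro t ht1 ht
      exact hmin t ht1 (ht.trans_lt (hf z hzB).1)
  omega

/-- There is a cycle cover whose cycles are unions of cycles of `σ`, with the cycles of `x` and `w`
in a common one. -/
def Mergeable (D : Digraph V) (σ : Perm V) (x w : V) : Prop :=
  ∃ ρ, IsCycleCover D ρ ∧ (∀ u v, SameCycle σ u v → SameCycle ρ u v) ∧ SameCycle ρ x w

/-- One random arc suffices for a merger if many arcs leave the cycles of the vertices in `I`. -/
theorem seqProb_not_mergeable_le_of_outside [Fintype V] [Nonempty V] {D : Digraph V} {σ : Perm V}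
    (hσ : IsCycleCover D σ) {I : Finset V} {S : V → Finset V} {q : ℕ}
    (hS : ∀ x ∈ I, ∀ y ∈ S x, D.Adj x (σ y) ∧ ¬ SameCycle σ x y) (hq : ∀ x ∈ I, q ≤ (S x).card)
    (m : ℕ) :
    seqProb m (fun T => ¬ ∃ x ∈ I, ∃ w, ¬ SameCycle σ x w ∧ Mergeable (addArcs D T) σ x w) ≤
      Real.exp (-(m * (I.card * q) / Fintype.card V ^ 2)) := by
  refine le_trans (seqProb_mono m fun T hT => ?_) (seqProb_disjoint_arcsInto_le m σ hq)
  rw [disjoint_left]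
  rintro ⟨y, u⟩ hyT hy
  obtain ⟨x, hx, hyS, rfl⟩ := mem_arcsInto.1 hy
  obtain ⟨hxy, hne⟩ := hS x hx y hyS
  exact hT ⟨x, hx, y, hne, merge_swap (hσ.addArcs T) hne (Or.inl hxy) (Or.inr hyT)⟩

/-- If many arcs stay inside the cycles of the vertices in `I`, then the cycle of one of these
vertices can be merged with one that meets `W`, by means of a path `y → σ w`, `w → σ z`, `z → σ x`
of random arcs. These are exposed in three rounds, in the order opposite to that of the path: the
first one provides `M₁` vertices `z`, the second one `M₂` vertices `w`. -/
theorem seqProb_not_mergeable_le_of_inside [Fintype V] [Nonempty V] {D : Digraph V} {σ : Perm V}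
    (hσ : IsCycleCover D σ) {I W : Finset V} (hIW : ∀ x ∈ I, ∀ w ∈ W, ¬ SameCycle σ x w)
    {B : V → Finset V} {q g : ℕ}
    (hB : ∀ x ∈ I, ∀ y ∈ B x, D.Adj x (σ y) ∧ SameCycle σ x y ∧ y ≠ x)
    (hq : ∀ x ∈ I, q + g ≤ (B x).card) {M₁ M₂ : ℕ} (hM₁ : M₁ ≤ Fintype.card V)
    (hM₂ : M₂ ≤ Fintype.card V) (m₁ m₂ m₃ : ℕ) :
    seqProb (m₁ + (m₂ + m₃))
        (fun T => ¬ ∃ x ∈ I, ∃ w ∈ W, Mergeable (addArcs D T) σ x w) ≤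
      (Fintype.card V : ℝ) ^ M₁ *
          Real.exp (-(m₁ * (I.card * ((q : ℝ) - M₁)) / Fintype.card V ^ 2)) +
        ((Fintype.card V : ℝ) ^ M₂ *
            Real.exp (-(m₂ * (M₁ * ((W.card : ℝ) - M₂)) / Fintype.card V ^ 2)) +
          Real.exp (-(m₃ * (M₂ * g) / Fintype.card V ^ 2))) := by
  classical
  set Q : V → Finset V := fun x =>
    univ.filter fun z => g ≤ ((B x).filter fun y => CyclicOrder σ x y z).card with hQ
  have hQq : ∀ x ∈ I, q ≤ (Q x).card := by
    intro x hx
    have h1 := card_le_card_cyclicOrder_add (σ := σ) (x := x) (B := B x)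
      (fun y hy => (hB x hx y hy).2) g
    have h2 := hq x hx
    have h3 : (B x).card ≤ (Q x).card + g := h1
    omega
  set P : Finset (V × V) → Prop :=
    fun T => ¬ ∃ x ∈ I, ∃ w ∈ W, Mergeable (addArcs D T) σ x w with hP
  have round1 := seqProb_add_le m₁ (m₂ + m₃) P
    (fun T => M₁ ≤ ((T ∩ arcsInto σ I Q).image Prod.fst).card)
    (ε := (Fintype.card V : ℝ) ^ M₂ *
            Real.exp (-(m₂ * (M₁ * ((W.card : ℝ) - M₂)) / Fintype.card V ^ 2)) +
          Real.exp (-(m₃ * (M₂ * g) / Fintype.card V ^ 2))) (by positivity) ?_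
  · refine round1.trans ?_
    gcongr
    simp only [not_le]
    exact seqProb_card_tails_arcsInto_lt_le m₁ σ hQq hM₁
  intro T₁ hT₁
  obtain ⟨Z, hZ, hZc⟩ := exists_subset_card_eq hT₁
  have round2 := seqProb_add_le m₂ m₃ (fun T => P (T₁ ∪ T))
    (fun T => M₂ ≤ ((T ∩ arcsInto σ Z fun _ => W).image Prod.fst).card)
    (ε := Real.exp (-(m₃ * (M₂ * g) / Fintype.card V ^ 2))) (by positivity) ?_
  · refine round2.trans ?_
    gcongr
    simp only [not_le]
    have := seqProb_card_tails_arcsInto_lt_le (I := Z) (S := fun _ => W) m₂ σ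
      (fun _ _ => le_rfl) hM₂
    rwa [hZc] at this
  intro T₂ hT₂
  obtain ⟨W', hW', hWc⟩ := exists_subset_card_eq hT₂
  -- every `w ∈ W'` starts a path `w → σ z`, `z → σ x` of arcs that have been exposed
  have hpath : ∀ w, ∃ p : V × V, w ∈ W' → w ∈ W ∧ (w, σ p.1) ∈ T₂ ∧ (p.1, σ p.2) ∈ T₁ ∧ p.2 ∈ I ∧
      p.1 ∈ Q p.2 := by
    intro w
    by_cases hw : w ∈ W'
    · obtain ⟨⟨w', u⟩, h1, rfl⟩ := mem_image.1 (hW' hw)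
      obtain ⟨h1, h2⟩ := mem_inter.1 h1
      obtain ⟨z, hz, hwW, rfl⟩ := mem_arcsInto.1 h2
      obtain ⟨⟨z', u⟩, h3, rfl⟩ := mem_image.1 (hZ hz)
      obtain ⟨h3, h4⟩ := mem_inter.1 h3
      obtain ⟨x, hx, hzQ, rfl⟩ := mem_arcsInto.1 h4
      exact ⟨(z', x), fun _ => ⟨hwW, h1, h3, hx, hzQ⟩⟩
    · obtain ⟨v⟩ := ‹Nonempty V›
      exact ⟨(v, v), fun h => absurd h hw⟩
  choose p hp using hpath
  have hg : ∀ w ∈ W', g ≤ ((B (p w).2).filter fun y => CyclicOrder σ (p w).2 y (p w).1).card := by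
    intro w hw
    have := (hp w hw).2.2.2.2
    simpa [hQ] using this
  have round3 := seqProb_disjoint_arcsInto_le m₃ σ hg
  rw [hWc] at round3
  refine le_trans (seqProb_mono m₃ fun T₃ hT₃ => ?_) round3
  rw [disjoint_left]
  rintro ⟨y, u⟩ hyT hy
  obtain ⟨w, hw, hyw, rfl⟩ := mem_arcsInto.1 hy
  obtain ⟨hyB, hord⟩ := mem_filter.1 hyw
  obtain ⟨hwW, hT2, hT1, hx, -⟩ := hp w hw
  refine hT₃ ⟨(p w).2, hx, w, hwW, merge_cycle4 (hσ.addArcs _) hord (hIW _ hx _ hwW)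
    (Or.inl (hB _ hx _ hyB).1) (Or.inr ?_) (Or.inr ?_) (Or.inr ?_)⟩
  · exact mem_union_right _ (mem_union_right _ hyT)
  · exact mem_union_right _ (mem_union_left _ hT2)
  · exact mem_union_left _ hT1

end RandomMerging

theorem eventually_sqrt_mul_log_le (c : ℝ) {κ : ℝ} (hκ : 0 < κ) :
    ∀ᶠ x : ℝ in atTop, √x * (2 * Real.log x + c) ≤ κ * x := by
  have h1 : (fun x : ℝ => 2 * Real.log x + c) =o[atTop] fun x : ℝ => √x := by
    simp only [Real.sqrt_eq_rpow]
    refine Asymptotics.IsLittleO.add ?_ ?_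
    · exact (isLittleO_log_rpow_atTop (by norm_num)).const_mul_left 2
    · refine Asymptotics.isLittleO_const_left.2 (Or.inr ?_)
      exact tendsto_norm_atTop_atTop.comp (tendsto_rpow_atTop (by norm_num))
  filter_upwards [h1.bound hκ, eventually_ge_atTop 0] with x hx hx0
  rw [Real.norm_eq_abs, Real.norm_eq_abs, abs_of_nonneg (Real.sqrt_nonneg x)] at hx
  calc √x * (2 * Real.log x + c) ≤ √x * (κ * √x) := by
        gcongr; exact (le_abs_self _).trans hx
    _ = κ * x := by rw [mul_left_comm, Real.mul_self_sqrt hx0]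

/-! ### Asymptotics of the mergers -/

section Asymptotics

open Equiv Equiv.Perm

theorem tendsto_nat_sqrt : Tendsto Nat.sqrt atTop atTop :=
  tendsto_atTop.2 fun b => by
    filter_upwards [eventually_ge_atTop (b * b)] with n hn
    exact Nat.le_sqrt.2 hn

theorem eventually_exp_neg_mul_le {f : ℕ → ℕ} (hf : Tendsto f atTop atTop) {κ ε : ℝ} (hκ : 0 < κ)
    (hε : 0 < ε) : ∀ᶠ n in atTop, Real.exp (-(κ * f n)) ≤ ε := by
  have h : Tendsto (fun n => Real.exp (-(κ * f n))) atTop (nhds 0) :=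
    Real.tendsto_exp_neg_atTop_nhds_zero.comp
      ((tendsto_natCast_atTop_atTop.comp hf).const_mul_atTop hκ)
  exact h.eventually_le_const hε

/-- The three error terms of `seqProb_not_mergeable_le_of_inside` tend to zero if `M₁` and `M₂` are
about `n ^ (1 / 2)` and `n ^ (1 / 4)`: with these choices the number of candidates for the set of the
first `M` tails is dominated by the probability of missing all the other arcs. -/
theorem eventually_inside_bound {δ a c ε : ℝ} (hδ : 0 < δ) (ha : 0 < a) (hc : 0 < c) (hε : 0 < ε) :
    ∀ᶠ n : ℕ in atTop, ∀ m₁ m₂ m₃ i w q : ℕ, δ * n ≤ m₁ → δ * n ≤ m₂ → δ * n ≤ m₃ → a * n ≤ i →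
      a * n ≤ w → c * n ≤ q →
      (n : ℝ) ^ (Nat.sqrt n) *
          Real.exp (-(m₁ * (i * ((q : ℝ) - Nat.sqrt n)) / (n : ℝ) ^ 2)) +
        ((n : ℝ) ^ (Nat.sqrt (Nat.sqrt n)) *
            Real.exp (-(m₂ * (Nat.sqrt n * ((w : ℝ) - Nat.sqrt (Nat.sqrt n))) / (n : ℝ) ^ 2)) +
          Real.exp (-(m₃ * (Nat.sqrt (Nat.sqrt n) * q) / (n : ℝ) ^ 2))) ≤ ε := by
  have hr := tendsto_nat_sqrt
  have ht := tendsto_nat_sqrt.comp tendsto_nat_sqrt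
  have hN := tendsto_natCast_atTop_atTop (R := ℝ)
  have hε3 : 0 < ε / 3 := by positivity
  set κ₁ := δ * (a * (c / 2)) / 2 with hκ₁
  set κ₂ := δ * (a / 2) / 2 with hκ₂
  have e1 := eventually_exp_neg_mul_le (tendsto_id (α := ℕ)) (κ := κ₁) (by positivity) hε3
  have e2 := eventually_exp_neg_mul_le hr (κ := κ₂) (by positivity) hε3
  have e3 := eventually_exp_neg_mul_le ht (κ := δ * c) (by positivity) hε3
  have f1 := hN.eventually (eventually_sqrt_mul_log_le 2 (κ := κ₁) (by positivity))
  have f2 := (hN.comp hr).eventually (eventually_sqrt_mul_log_le 2 (κ := κ₂) (by positivity))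
  have g1 := hN.eventually (eventually_sqrt_mul_log_le 2 (κ := c / 2) (by positivity))
  have g2 := hN.eventually (eventually_sqrt_mul_log_le 2 (κ := a / 2) (by positivity))
  filter_upwards [e1, e2, e3, f1, f2, g1, g2, eventually_gt_atTop 0,
    hr.eventually (eventually_gt_atTop 0)] with n e1 e2 e3 f1 f2 g1 g2 hn hr0 m₁ m₂ m₃ i w q hm₁ hm₂
      hm₃ hi hw hq
  simp only [Function.comp_apply, id_eq] at e1 e2 e3 f2
  set r := Nat.sqrt n with hrdef
  set t := Nat.sqrt r with htdef
  have hn1 : (1 : ℝ) ≤ n := by exact_mod_cast hn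
  have hn0 : (0 : ℝ) < n := by linarith
  have hr1 : (1 : ℝ) ≤ r := by exact_mod_cast hr0
  have hrn : (r : ℝ) ≤ √n := Real.nat_sqrt_le_real_sqrt
  have htr : (t : ℝ) ≤ √r := Real.nat_sqrt_le_real_sqrt
  have htn : (t : ℝ) ≤ √n := htr.trans (Real.sqrt_le_sqrt (by exact_mod_cast Nat.sqrt_le_self n))
  have hlogn : 0 ≤ Real.log n := Real.log_nonneg hn1
  have hlogr : 0 ≤ Real.log r := Real.log_nonneg hr1
  have hsn : 0 ≤ √(n : ℝ) := Real.sqrt_nonneg _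
  have hsr : 0 ≤ √(r : ℝ) := Real.sqrt_nonneg _
  have hsn1 : √(n : ℝ) ≤ √n * (2 * Real.log n + 2) := by nlinarith
  -- `n < (r + 1) ^ 2 ≤ (2 r) ^ 2`
  have hlognr : Real.log n ≤ 2 * Real.log r + 2 := by
    have h1 : (n : ℝ) ≤ (2 * r) ^ 2 := by
      have : n ≤ (2 * r) ^ 2 := by
        have := Nat.lt_succ_sqrt' n
        have h2 : Nat.succ (Nat.sqrt n) ≤ 2 * r := by omega
        exact this.le.trans (Nat.pow_le_pow_left h2 2)
      exact_mod_cast this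
    have h2 := Real.log_le_log hn0 h1
    rw [Real.log_pow, Real.log_mul (by norm_num) (by linarith)] at h2
    have h3 : Real.log 2 ≤ 1 := by
      have := Real.log_le_sub_one_of_pos (show (0 : ℝ) < 2 by norm_num)
      linarith
    push_cast at h2
    linarith
  have t1 : (n : ℝ) ^ r * Real.exp (-(m₁ * (i * ((q : ℝ) - r)) / (n : ℝ) ^ 2)) ≤ ε / 3 := by
    refine le_trans ?_ e1
    rw [← Real.exp_log (pow_pos hn0 r), Real.log_pow, ← Real.exp_add]
    apply Real.exp_le_exp.2
    have h1 : r * Real.log n ≤ κ₁ * n := by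
      refine le_trans ?_ f1
      gcongr
      linarith
    have h2 : c / 2 * n ≤ (q : ℝ) - r := by linarith
    have h3 : 2 * κ₁ * n ≤ m₁ * (i * ((q : ℝ) - r)) / (n : ℝ) ^ 2 := by
      rw [le_div_iff₀ (by positivity)]
      calc 2 * κ₁ * n * (n : ℝ) ^ 2 = (δ * n) * ((a * n) * (c / 2 * n)) := by rw [hκ₁]; ring
        _ ≤ _ := by gcongr
    linarith
  have t2 : (n : ℝ) ^ t * Real.exp (-(m₂ * (r * ((w : ℝ) - t)) / (n : ℝ) ^ 2)) ≤ ε / 3 := by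
    refine le_trans ?_ e2
    rw [← Real.exp_log (pow_pos hn0 t), Real.log_pow, ← Real.exp_add]
    apply Real.exp_le_exp.2
    have h1 : t * Real.log n ≤ κ₂ * r := by
      refine le_trans ?_ f2
      gcongr
    have h2 : a / 2 * n ≤ (w : ℝ) - t := by linarith
    have h3 : 2 * κ₂ * r ≤ m₂ * (r * ((w : ℝ) - t)) / (n : ℝ) ^ 2 := by
      rw [le_div_iff₀ (by positivity)]
      calc 2 * κ₂ * r * (n : ℝ) ^ 2 = (δ * n) * (r * (a / 2 * n)) := by rw [hκ₂]; ring
        _ ≤ _ := by gcongr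
    linarith
  have t3 : Real.exp (-(m₃ * (t * q) / (n : ℝ) ^ 2)) ≤ ε / 3 := by
    refine le_trans ?_ e3
    apply Real.exp_le_exp.2
    have h3 : δ * c * t ≤ m₃ * (t * q) / (n : ℝ) ^ 2 := by
      rw [le_div_iff₀ (by positivity)]
      calc δ * c * t * (n : ℝ) ^ 2 = (δ * n) * (t * (c * n)) := by ring
        _ ≤ _ := by gcongr
    linarith
  linarith

open scoped Classical in
/-- In a digraph with linear out-degrees and a cycle cover with linear cycles, linearly many random
arcs almost surely allow to merge the cycle of a given vertex `v` with another one. -/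
theorem eventually_seqProb_not_mergeable_le {d a δ ε : ℝ} (hd : 0 < d) (ha : 0 < a) (hδ : 0 < δ)
    (hε : 0 < ε) :
    ∀ᶠ n : ℕ in atTop, ∀ D : Digraph (Fin n), (∀ v, d * n ≤ outDeg D v) → ∀ σ, IsCycleCover D σ →
      (∀ u, a * n ≤ (univ.filter fun w => SameCycle σ u w).card) →
      ∀ v u₀, ¬ SameCycle σ v u₀ → ∀ m : ℕ, δ * n ≤ m →
        seqProb m (fun T => ¬ ∃ w, ¬ SameCycle σ v w ∧ Mergeable (addArcs D T) σ v w) ≤ ε := by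
  have hN := tendsto_natCast_atTop_atTop (R := ℝ)
  have e1 := eventually_inside_bound (δ := δ / 4) (a := a / 2) (c := d / 8) (by positivity)
    (by positivity) (by positivity) hε
  have e2 := eventually_exp_neg_mul_le (tendsto_id (α := ℕ)) (κ := δ * (a / 2 * (d / 2)))
    (by positivity) hε
  filter_upwards [e1, e2, eventually_gt_atTop 0, hN.eventually (eventually_ge_atTop (12 / d)),
    hN.eventually (eventually_ge_atTop (8 / δ))] with n e1 e2 hn hnd hnδ D hD σ hσ hcyc v u₀ hu₀ m hm
  rw [div_le_iff₀ hd] at hnd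
  rw [div_le_iff₀ hδ] at hnδ
  have hn0 : (0 : ℝ) < n := by exact_mod_cast hn
  have : Nonempty (Fin n) := ⟨⟨0, hn⟩⟩
  set C := univ.filter fun w => SameCycle σ v w with hC
  set out : Fin n → Finset (Fin n) := fun x => univ.filter fun y => D.Adj x (σ y) with hout
  have hout_card : ∀ x, (out x).card = outDeg D x := fun x => card_filter_adj_apply D σ x
  set p : Fin n → Prop := fun x => d / 2 * n ≤ ((out x).filter fun y => ¬ SameCycle σ x y).card
    with hp
  have hCsplit := card_filter_add_card_filter_not (s := C) p
  have hCcard : a * n ≤ (C.filter p).card + (C.filter fun x => ¬ p x).card := by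
    rw [← Nat.cast_add, hCsplit]; exact hcyc v
  by_cases hcase : a / 2 * n ≤ (C.filter p).card
  · -- many arcs leave the cycle of `v`
    have key := seqProb_not_mergeable_le_of_outside hσ (I := C.filter p)
      (S := fun x => (out x).filter fun y => ¬ SameCycle σ x y) (q := ⌈d / 2 * n⌉₊)
      (fun x _ y hy => by simpa [hout] using hy)
      (fun x hx => Nat.ceil_le.2 (mem_filter.1 hx).2) m
    refine (seqProb_mono m fun T hT => ?_).trans (key.trans (le_trans ?_ e2))
    · rintro ⟨x, hx, w, hxw, ρ, hρ, hmono, hρw⟩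
      have hvx : SameCycle σ v x := (mem_filter.1 (mem_filter.1 hx).1).2
      exact hT ⟨w, fun h => hxw (hvx.symm.trans h), ρ, hρ, hmono, (hmono _ _ hvx).trans hρw⟩
    · apply Real.exp_le_exp.2
      rw [neg_le_neg_iff, Fintype.card_fin,
        le_div_iff₀ (by positivity)]
      calc δ * (a / 2 * (d / 2)) * ((id n : ℕ) : ℝ) * (n : ℝ) ^ 2
          = (δ * n) * ((a / 2 * n) * (d / 2 * n)) := by rw [id_eq]; ring
        _ ≤ _ := by
          gcongr
          exact Nat.le_ceil _
  · -- many arcs stay inside the cycle of `v`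
    set I := C.filter fun x => ¬ p x with hI
    set W := univ.filter fun w => SameCycle σ u₀ w with hW
    have hIc : a / 2 * n ≤ I.card := by linarith
    set B : Fin n → Finset (Fin n) := fun x =>
      ((out x).filter fun y => SameCycle σ x y).erase x with hB
    set q := ⌈d / 8 * n⌉₊ with hq
    have hqB : ∀ x ∈ I, q + q ≤ (B x).card := by
      intro x hx
      have h1 : ((out x).filter fun y => ¬ SameCycle σ x y).card < d / 2 * n :=
        not_le.1 (mem_filter.1 hx).2
      have h2 : (((out x).filter fun y => SameCycle σ x y).card : ℝ) +
          ((out x).filter fun y => ¬ SameCycle σ x y).card = outDeg D x := by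
        rw [← hout_card]
        exact_mod_cast card_filter_add_card_filter_not (s := out x) fun y => SameCycle σ x y
      have h3 : ((out x).filter fun y => SameCycle σ x y).card ≤ (B x).card + 1 :=
        Nat.sub_le_iff_le_add.1 pred_card_le_card_erase
      have h3' : (((out x).filter fun y => SameCycle σ x y).card : ℝ) ≤ (B x).card + 1 := by
        exact_mod_cast h3
      have h4 := hD x
      have h5 : (q : ℝ) < d / 8 * n + 1 := Nat.ceil_lt_add_one (by positivity)
      have h6 : (q : ℝ) + q ≤ (B x).card := by linarith
      exact_mod_cast h6
    set m₁ := ⌈δ / 4 * n⌉₊ with hm₁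
    have hm₁' : δ / 4 * n ≤ m₁ := Nat.le_ceil _
    have hm₁'' : (m₁ : ℝ) < δ / 4 * n + 1 := Nat.ceil_lt_add_one (by positivity)
    have h2m : 2 * m₁ ≤ m := by
      have : (2 : ℝ) * m₁ ≤ m := by linarith
      exact_mod_cast this
    obtain ⟨m₃, rfl⟩ : ∃ m₃, m = m₁ + (m₁ + m₃) := ⟨m - 2 * m₁, by omega⟩
    have hm₃ : δ / 4 * n ≤ m₃ := by push_cast at hm; linarith
    have hsn : Nat.sqrt n ≤ n := Nat.sqrt_le_self n
    have key := seqProb_not_mergeable_le_of_inside hσ (I := I) (W := W) (B := B) (q := q) (g := q)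
      (fun x hx w hw h => hu₀ ?_) (fun x hx y hy => ?_) hqB (M₁ := Nat.sqrt n)
      (M₂ := Nat.sqrt (Nat.sqrt n)) (by rwa [Fintype.card_fin])
      (by rw [Fintype.card_fin]; exact (Nat.sqrt_le_self _).trans hsn) m₁ m₁ m₃
    · refine (seqProb_mono _ fun T hT => ?_).trans (key.trans ?_)
      · rintro ⟨x, hx, w, hw, ρ, hρ, hmono, hρw⟩
        have hvx : SameCycle σ v x := (mem_filter.1 (mem_filter.1 hx).1).2
        refine hT ⟨w, fun h => hu₀ (h.trans (mem_filter.1 hw).2.symm), ρ, hρ, hmono,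
          (hmono _ _ hvx).trans hρw⟩
      · rw [Fintype.card_fin]
        refine e1 m₁ m₁ m₃ I.card W.card q hm₁' hm₁' hm₃ hIc ?_ (Nat.le_ceil _)
        have := hcyc u₀
        have h0 : 0 ≤ a * n := by positivity
        linarith
    · have hvx : SameCycle σ v x := (mem_filter.1 (mem_filter.1 hx).1).2
      exact hvx.trans (h.trans (mem_filter.1 hw).2.symm)
    · obtain ⟨hne, hy⟩ := mem_erase.1 hy
      obtain ⟨hy1, hy2⟩ := mem_filter.1 hy
      exact ⟨(mem_filter.1 hy1).2, hy2, hne⟩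

theorem addArcs_addArcs {V : Type*} [DecidableEq V] (D : Digraph V) (S T : Finset (V × V)) :
    addArcs (addArcs D S) T = addArcs D (S ∪ T) := by
  ext x y
  simp [addArcs, or_assoc]

theorem IsHamiltonianDigraph.addArcs {V : Type*} [Fintype V] {D : Digraph V}
    (h : IsHamiltonianDigraph D) (T : Finset (V × V)) : IsHamiltonianDigraph (addArcs D T) := by
  obtain ⟨c, hc⟩ := h
  exact ⟨c, fun i => Or.inl (hc i)⟩

theorem outDeg_le_outDeg_addArcs {V : Type*} [Fintype V] (D : Digraph V) (T : Finset (V × V))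
    (v : V) : outDeg D v ≤ outDeg (addArcs D T) v := by
  classical
  unfold outDeg
  refine card_le_card fun w hw => ?_
  simp only [mem_filter, mem_univ, true_and] at hw ⊢
  exact Or.inl hw

theorem inDeg_le_inDeg_addArcs {V : Type*} [Fintype V] (D : Digraph V) (T : Finset (V × V))
    (v : V) : inDeg D v ≤ inDeg (addArcs D T) v := by
  classical
  unfold inDeg
  refine card_le_card fun w hw => ?_
  simp only [mem_filter, mem_univ, true_and] at hw ⊢
  exact Or.inl hw

open scoped Classical in
/-- Each merger enlarges the cycle of `v` by at least `a n` vertices, so that a bounded number of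
mergers produces a Hamilton cycle. -/
theorem eventually_seqProb_not_isHamiltonian_le_aux {d a : ℝ} (hd : 0 < d) (ha : 0 < a) (j : ℕ) :
    ∀ δ ε : ℝ, 0 < δ → 0 < ε → ∀ᶠ n : ℕ in atTop, ∀ D : Digraph (Fin n),
      (∀ v, d * n ≤ outDeg D v) → ∀ σ, IsCycleCover D σ →
      (∀ u, a * n ≤ (univ.filter fun w => SameCycle σ u w).card) →
      ∀ v, n - j * (a * n) ≤ (univ.filter fun w => SameCycle σ v w).card → ∀ m : ℕ, δ * n ≤ m →
        seqProb m (fun T => ¬ IsHamiltonianDigraph (addArcs D T)) ≤ ε := by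
  induction j with
  | zero =>
    intro δ ε _ hε
    filter_upwards with n D _ σ hσ _ v hv m _
    have hall : ∀ w, SameCycle σ v w := by
      have h1 : (univ.filter fun w => SameCycle σ v w) = univ := by
        refine eq_univ_of_card _ (le_antisymm (card_le_univ _) ?_)
        rw [Fintype.card_fin]
        have : (n : ℝ) ≤ (univ.filter fun w => SameCycle σ v w).card := by simpa using hv
        exact_mod_cast this
      intro w
      exact (mem_filter.1 (h1 ▸ mem_univ w)).2
    rw [seqProb_eq_zero]
    · exact hε.le
    · intro T hT
      exact hT ((isHamiltonianDigraph_of_sameCycle hσ v hall).addArcs T)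
  | succ j ih =>
    intro δ ε hδ hε
    have hN := tendsto_natCast_atTop_atTop (R := ℝ)
    filter_upwards [ih (δ / 4) (ε / 2) (by positivity) (by positivity),
      eventually_seqProb_not_mergeable_le hd ha (δ := δ / 4) (ε := ε / 2) (by positivity)
        (by positivity), hN.eventually (eventually_ge_atTop (2 / δ))]
      with n ih hmerge hnδ D hD σ hσ hcyc v hv m hm
    rw [div_le_iff₀ hδ] at hnδ
    by_cases hall : ∀ w, SameCycle σ v w
    · rw [seqProb_eq_zero]
      · exact hε.le
      · intro T hT
        exact hT ((isHamiltonianDigraph_of_sameCycle hσ v hall).addArcs T)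
    push Not at hall
    obtain ⟨u₀, hu₀⟩ := hall
    set m₁ := ⌈δ / 4 * n⌉₊ with hm₁
    have hm₁' : δ / 4 * n ≤ m₁ := Nat.le_ceil _
    have hm₁'' : (m₁ : ℝ) < δ / 4 * n + 1 := Nat.ceil_lt_add_one (by positivity)
    have h2m : m₁ ≤ m := by
      have : (m₁ : ℝ) ≤ m := by linarith
      exact_mod_cast this
    obtain ⟨m₂, rfl⟩ : ∃ m₂, m = m₁ + m₂ := ⟨m - m₁, by omega⟩
    have hm₂ : δ / 4 * n ≤ m₂ := by push_cast at hm; linarith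
    have key := seqProb_add_le m₁ m₂ (fun T => ¬ IsHamiltonianDigraph (addArcs D T))
      (fun T => ∃ w, ¬ SameCycle σ v w ∧ Mergeable (addArcs D T) σ v w) (ε := ε / 2)
      (by positivity) ?_
    · linarith [hmerge D hD σ hσ hcyc v u₀ hu₀ m₁ hm₁']
    rintro T ⟨w, hvw, ρ, hρ, hmono, hρw⟩
    simp only [← addArcs_addArcs]
    refine ih (addArcs D T) (fun u => (hD u).trans ?_) ρ hρ (fun u => (hcyc u).trans ?_) v ?_ m₂ hm₂
    · exact_mod_cast outDeg_le_outDeg_addArcs D T u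
    · have : (univ.filter fun w => SameCycle σ u w) ⊆ univ.filter fun w => SameCycle ρ u w :=
        fun x hx => by simpa using hmono _ _ (mem_filter.1 hx).2
      exact_mod_cast card_le_card this
    · have hdisj : Disjoint (univ.filter fun x => SameCycle σ v x)
          (univ.filter fun x => SameCycle σ w x) := by
        rw [disjoint_left]
        intro x hx hx'
        exact hvw ((mem_filter.1 hx).2.trans (mem_filter.1 hx').2.symm)
      have hsub : (univ.filter fun x => SameCycle σ v x) ∪ (univ.filter fun x => SameCycle σ w x) ⊆
          univ.filter fun x => SameCycle ρ v x := by
        intro x hx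
        refine mem_filter.2 ⟨mem_univ _, ?_⟩
        rcases mem_union.1 hx with hx | hx
        · exact hmono _ _ (mem_filter.1 hx).2
        · exact hρw.trans (hmono _ _ (mem_filter.1 hx).2)
      have h1 := card_le_card hsub
      rw [card_union_of_disjoint hdisj] at h1
      have h2 : ((univ.filter fun x => SameCycle σ v x).card : ℝ) +
          (univ.filter fun x => SameCycle σ w x).card ≤
          (univ.filter fun x => SameCycle ρ v x).card := by exact_mod_cast h1
      have h3 := hcyc w
      push_cast at hv
      linarith

end Asymptotics

/-! ### Hamiltonicity with sufficiently many random arcs -/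

section UpperBound

open Equiv Equiv.Perm

/-- `n` random arcs almost surely turn a digraph with linear minimum degrees in which all sets of
`d n / 4` vertices are joined into a Hamiltonian one. -/
theorem eventually_seqProb_not_isHamiltonian_le_of_setsJoined {d : ℝ} (hd : 0 < d) {ε : ℝ}
    (hε : 0 < ε) :
    ∀ᶠ n : ℕ in atTop, ∀ D : Digraph (Fin n), D ∈ DenseDigraphs n d →
      SetsJoined D ⌈d / 4 * n⌉₊ →
        seqProb n (fun T => ¬ IsHamiltonianDigraph (addArcs D T)) ≤ ε := by
  classical
  have hN := tendsto_natCast_atTop_atTop (R := ℝ)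
  filter_upwards [eventually_seqProb_not_isHamiltonian_le_aux hd (a := d / 8) (by positivity)
    ⌈8 / d⌉₊ 1 ε one_pos hε, eventually_gt_atTop 0, hN.eventually (eventually_ge_atTop (16 / d))]
    with n key hn hnd D hD hjoin
  rw [div_le_iff₀ hd] at hnd
  have hn0 : (0 : ℝ) < n := by exact_mod_cast hn
  set b := ⌈d / 4 * n⌉₊ with hb
  have hb' : (b : ℝ) < d / 4 * n + 1 := Nat.ceil_lt_add_one (by positivity)
  set L := ⌊d / 8 * n⌋₊ with hL
  have hL' : (L : ℝ) ≤ d / 8 * n := Nat.floor_le (by positivity)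
  have hL'' : d / 8 * n < (L : ℝ) + 1 := Nat.lt_floor_add_one _
  -- `2 * (d / 4) + 3 * (d / 8) < d`
  have hk : 2 * b + 3 * L ≤ ⌈d * n⌉₊ := by
    have h1 := Nat.le_ceil (d * n)
    have : (2 : ℝ) * b + 3 * L ≤ ⌈d * n⌉₊ := by linarith
    exact_mod_cast this
  obtain ⟨σ, hσ, hlong⟩ := exists_isCycleCover_of_joined hjoin
    (fun v => Nat.ceil_le.2 (hD v).1) (fun v => Nat.ceil_le.2 (hD v).2) hk
  refine key D (fun v => (hD v).1) σ hσ (fun u => ?_) ⟨0, hn⟩ ?_ n (by simp)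
  · obtain ⟨l, hl1, hlu, hmin⟩ := exists_minimal_period σ u
    have hLl : L + 1 ≤ l := by
      by_contra! h
      exact hlong u l hl1 (by omega) hlu
    have h1 : (range l).card ≤ (univ.filter fun w => SameCycle σ u w).card := by
      refine card_le_card_of_injOn (fun i => (σ ^ i) u) (fun i _ => ?_) ?_
      · simp [SameCycle.refl]
      · intro i hi j hj hij
        exact eq_of_pow_apply_eq hmin (by simpa using hi) (by simpa using hj) hij
    rw [card_range] at h1
    have h2 : ((L + 1 : ℕ) : ℝ) ≤ (univ.filter fun w => SameCycle σ u w).card := by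
      exact_mod_cast hLl.trans h1
    push_cast at h2
    linarith
  · have h1 : (n : ℝ) ≤ ⌈8 / d⌉₊ * (d / 8 * n) := by
      calc (n : ℝ) = 8 / d * (d / 8 * n) := by field_simp
        _ ≤ _ := by gcongr; exact Nat.le_ceil _
    have h2 : (0 : ℝ) ≤ (univ.filter fun w => SameCycle σ ⟨0, hn⟩ w).card := Nat.cast_nonneg _
    linarith

theorem one_sub_seqProb_le_randomArcProb {V : Type*} [Fintype V] [DecidableEq V] [Nonempty V]
    (H : Digraph V) {m : ℕ} (hm : m ≤ (nonArcs H).card) :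
    1 - seqProb m (fun T => ¬ IsHamiltonianDigraph (addArcs H T)) ≤
      randomArcProb H m IsHamiltonianDigraph := by
  classical
  have key := levelCount_le_seqProb (nonArcs H) m hm
    (fun T => ¬ IsHamiltonianDigraph (addArcs H T)) ?_ ?_
  · have hpos : (0 : ℝ) < (nonArcs H).card.choose m := by exact_mod_cast Nat.choose_pos hm
    have h1 := card_filter_add_card_filter_not (s := (nonArcs H).powersetCard m)
      (fun T => IsHamiltonianDigraph (addArcs H T))
    rw [card_powersetCard] at h1
    have h2 : randomArcProb H m IsHamiltonianDigraph =
        (((nonArcs H).powersetCard m).filter fun T =>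
          IsHamiltonianDigraph (addArcs H T)).card / (nonArcs H).card.choose m := by
      unfold randomArcProb
      rw [card_powersetCard]
    have h3 : levelCount (nonArcs H) m (fun T => ¬ IsHamiltonianDigraph (addArcs H T)) =
        (((nonArcs H).powersetCard m).filter fun T =>
          ¬ IsHamiltonianDigraph (addArcs H T)).card := by
      unfold levelCount
      congr!
    rw [h3] at key
    rw [h2]
    have h4 : ((((nonArcs H).powersetCard m).filter fun T =>
          IsHamiltonianDigraph (addArcs H T)).card : ℝ) + (((nonArcs H).powersetCard m).filter
          fun T => ¬ IsHamiltonianDigraph (addArcs H T)).card = (nonArcs H).card.choose m := by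
      exact_mod_cast h1
    have h5 : ((((nonArcs H).powersetCard m).filter fun T =>
          IsHamiltonianDigraph (addArcs H T)).card : ℝ) / (nonArcs H).card.choose m +
          (((nonArcs H).powersetCard m).filter
          fun T => ¬ IsHamiltonianDigraph (addArcs H T)).card / (nonArcs H).card.choose m = 1 := by
      rw [← add_div, h4, div_self hpos.ne']
    linarith
  · intro p T hT hH
    refine hT ?_
    rw [insert_eq, union_comm, ← addArcs_addArcs]
    exact hH.addArcs _
  · intro p hp T hT hH
    refine hT ?_
    have hadj : H.Adj p.1 p.2 := by simpa [nonArcs] using hp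
    have : addArcs H (insert p T) = addArcs H T := by
      ext x y
      simp only [addArcs, mem_insert]
      constructor
      · rintro (h | h | h)
        · exact Or.inl h
        · left; rw [← h] at hadj; exact hadj
        · exact Or.inr h
      · rintro (h | h)
        · exact Or.inl h
        · exact Or.inr (Or.inr h)
    rwa [this] at hH

/-- Even after `n` of the random arcs have been set aside, there are enough of them to join all pairs
of sets of `d n / 4` vertices. -/
theorem two_mul_one_add_log_lt {d : ℝ} (hd0 : 0 < d) (hd : d < 1 / 2) :
    2 * (1 + Real.log (d / 4)⁻¹) <
      (d⁻¹ * (15 + 6 * Real.log d⁻¹) + 5 * d⁻¹ ^ 2 - 1) * (d / 4) := by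
  set z := d⁻¹ with hz
  have hz2 : 2 < z := by
    rw [hz, lt_inv_comm₀ (by norm_num) hd0]; linarith
  have hzd : z * d = 1 := inv_mul_cancel₀ hd0.ne'
  have h1 : Real.log (d / 4)⁻¹ = 2 * Real.log 2 + Real.log z := by
    rw [inv_div, div_eq_mul_inv, Real.log_mul (by norm_num) (by positivity),
      show (4 : ℝ) = 2 ^ 2 by norm_num, Real.log_pow]
    norm_num [hz]
  have h2 : Real.log z ≤ z - 1 := Real.log_le_sub_one_of_pos (by linarith)
  have h3 := Real.log_two_lt_d9
  have h4 : (z * (15 + 6 * Real.log z) + 5 * z ^ 2 - 1) * (d / 4) =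
      (15 + 6 * Real.log z + 5 * z - d) / 4 := by
    linear_combination ((15 + 6 * Real.log z) / 4 + 5 * z / 4) * hzd
  rw [h1, h4]
  linarith

theorem eventually_le_randomArcProb_isHamiltonian {d : ℝ} (hd0 : 0 < d) (hd : d < 1 / 2) {ε : ℝ}
    (hε : 0 < ε) :
    ∀ᶠ n : ℕ in atTop, ∀ H : Digraph (Fin n), H ∈ DenseDigraphs n d →
      ∀ m : ℕ, (d⁻¹ * (15 + 6 * Real.log d⁻¹) + 5 * d⁻¹ ^ 2) * (n : ℝ) ≤ (m : ℝ) →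
        m ≤ (nonArcs H).card → 1 - ε ≤ randomArcProb H m IsHamiltonianDigraph := by
  set c := d⁻¹ * (15 + 6 * Real.log d⁻¹) + 5 * d⁻¹ ^ 2 with hc
  have hc1 : 1 ≤ c := by
    have hz : 2 < d⁻¹ := by
      rw [lt_inv_comm₀ (by norm_num) hd0]; linarith
    have hlog : 0 ≤ Real.log d⁻¹ := Real.log_nonneg (by linarith)
    nlinarith [mul_nonneg (by linarith : (0 : ℝ) ≤ d⁻¹) hlog]
  filter_upwards [eventually_seqProb_not_setsJoined_le (by positivity : 0 < d / 4)
    (two_mul_one_add_log_lt hd0 hd) (half_pos hε),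
    eventually_seqProb_not_isHamiltonian_le_of_setsJoined hd0 (half_pos hε), eventually_gt_atTop 0]
    with n h1 h2 hn H hH m hm hmN
  have : Nonempty (Fin n) := ⟨⟨0, hn⟩⟩
  refine le_trans ?_ (one_sub_seqProb_le_randomArcProb H hmN)
  have hnm : n ≤ m := by
    have : (n : ℝ) ≤ m := le_trans (le_mul_of_one_le_left (Nat.cast_nonneg n) hc1) hm
    exact_mod_cast this
  obtain ⟨m₁, rfl⟩ : ∃ m₁, m = m₁ + n := ⟨m - n, by omega⟩
  have key := seqProb_add_le m₁ n (fun T => ¬ IsHamiltonianDigraph (addArcs H T))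
    (fun T => SetsJoined (addArcs H T) ⌈d / 4 * n⌉₊) (half_pos hε).le ?_
  · have := h1 H m₁ (by push_cast at hm; linarith)
    linarith
  · intro T hT
    simp only [← addArcs_addArcs]
    refine h2 _ (fun v => ⟨(hH v).1.trans ?_, (hH v).2.trans ?_⟩) hT
    · exact_mod_cast outDeg_le_outDeg_addArcs H T v
    · exact_mod_cast inDeg_le_inDeg_addArcs H T v

end UpperBound

/-! ### Random subsets of fixed size avoiding disjoint sets -/

section Avoiding

theorem card_filter_disjoint_powersetCard {α : Type*} [DecidableEq α] {N E : Finset α}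
    (hE : E ⊆ N) (m : ℕ) :
    ((N.powersetCard m).filter fun R => Disjoint R E).card = (N.card - E.card).choose m := by
  rw [← card_sdiff_of_subset hE, ← card_powersetCard]
  congr 1
  ext R
  simp only [mem_filter, mem_powersetCard, subset_sdiff]
  tauto

theorem descFactorial_mul_descFactorial_le (M b m : ℕ) :
    (M - 2 * b).descFactorial m * M.descFactorial m ≤ (M - b).descFactorial m ^ 2 := by
  induction m with
  | zero => simp
  | succ m ih =>
    simp only [Nat.descFactorial_succ]
    have h : (M - 2 * b - m) * (M - m) ≤ (M - b - m) ^ 2 := by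
      rcases le_or_gt (2 * b + m) M with hle | hlt
      · obtain ⟨x, rfl⟩ := Nat.exists_eq_add_of_le hle
        rw [show 2 * b + m + x - 2 * b - m = x by omega, show 2 * b + m + x - m = 2 * b + x by omega,
          show 2 * b + m + x - b - m = b + x by omega]
        nlinarith
      · rw [show M - 2 * b - m = 0 by omega]; simp
    calc _ = ((M - 2 * b - m) * (M - m)) * ((M - 2 * b).descFactorial m * M.descFactorial m) := by
          ring
      _ ≤ (M - b - m) ^ 2 * (M - b).descFactorial m ^ 2 := Nat.mul_le_mul h ih
      _ = _ := by ring

/-- Avoiding two disjoint `b`-sets is negatively correlated for a random `m`-subset. -/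
theorem choose_mul_choose_le (M b m : ℕ) :
    (M - 2 * b).choose m * M.choose m ≤ (M - b).choose m ^ 2 := by
  have h := descFactorial_mul_descFactorial_le M b m
  simp only [Nat.descFactorial_eq_factorial_mul_choose] at h
  have hm : 0 < m.factorial ^ 2 := pow_pos (Nat.factorial_pos m) 2
  refine Nat.le_of_mul_le_mul_left ?_ hm
  calc _ = m.factorial * (M - 2 * b).choose m * (m.factorial * M.choose m) := by ring
    _ ≤ _ := h
    _ = _ := by ring

theorem exp_le_choose_div_choose {M b m : ℕ} (h : m + b < M) :
    Real.exp (-(m * b / ((M : ℝ) - b - m))) ≤ ((M - b).choose m : ℝ) / M.choose m := by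
  have hdesc : ∀ j ≤ m,
      (M - b - m) ^ j * M.descFactorial j ≤ (M - b).descFactorial j * (M - m) ^ j := by
    intro j hj
    induction j with
    | zero => simp
    | succ j ih =>
      simp only [Nat.descFactorial_succ]
      have h1 : (M - b - m) * (M - j) ≤ (M - b - j) * (M - m) := by
        obtain ⟨x, rfl⟩ := Nat.exists_eq_add_of_le h.le
        obtain ⟨y, rfl⟩ := Nat.exists_eq_add_of_le (show j ≤ m by omega)
        rw [show j + y + b + x - b - (j + y) = x by omega,
          show j + y + b + x - j = y + b + x by omega,
          show j + y + b + x - b - j = y + x by omega,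
          show j + y + b + x - (j + y) = b + x by omega]
        nlinarith
      calc _ = ((M - b - m) * (M - j)) * ((M - b - m) ^ j * M.descFactorial j) := by ring
        _ ≤ ((M - b - j) * (M - m)) * ((M - b).descFactorial j * (M - m) ^ j) :=
          Nat.mul_le_mul h1 (ih (by omega))
        _ = _ := by ring
  have h1 := hdesc m le_rfl
  simp only [Nat.descFactorial_eq_factorial_mul_choose] at h1
  have h2 : (M - b - m) ^ m * M.choose m ≤ (M - b).choose m * (M - m) ^ m := by
    refine Nat.le_of_mul_le_mul_left ?_ (Nat.factorial_pos m)
    calc _ = (M - b - m) ^ m * (m.factorial * M.choose m) := by ring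
      _ ≤ _ := h1
      _ = _ := by ring
  have h3 : ((M : ℝ) - b - m) ^ m * M.choose m ≤ (M - b).choose m * ((M : ℝ) - m) ^ m := by
    have e1 : ((M - b - m : ℕ) : ℝ) = (M : ℝ) - b - m := by
      rw [Nat.cast_sub (by omega), Nat.cast_sub (by omega)]
    have e2 : ((M - m : ℕ) : ℝ) = (M : ℝ) - m := Nat.cast_sub (by omega)
    rw [← e1, ← e2]
    exact_mod_cast h2
  have hM : (m : ℝ) + b < M := by exact_mod_cast h
  have hb0 : (0 : ℝ) ≤ b := Nat.cast_nonneg b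
  have hpos : (0 : ℝ) < (M : ℝ) - b - m := by linarith
  have hpos' : (0 : ℝ) < (M : ℝ) - m := by linarith
  have hch : (0 : ℝ) < M.choose m := by exact_mod_cast Nat.choose_pos (by omega)
  rw [le_div_iff₀ hch, mul_div_assoc, ← mul_neg, Real.exp_nat_mul]
  have h4 : Real.exp (-(b / ((M : ℝ) - b - m))) ≤ ((M : ℝ) - b - m) / (M - m) := by
    rw [Real.exp_neg, ← inv_div ((M : ℝ) - m)]
    apply inv_anti₀ (by positivity)
    calc ((M : ℝ) - m) / (M - b - m) = b / ((M : ℝ) - b - m) + 1 := by field_simp; ring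
      _ ≤ _ := Real.add_one_le_exp _
  calc Real.exp (-(b / ((M : ℝ) - b - m))) ^ m * M.choose m
      ≤ (((M : ℝ) - b - m) / (M - m)) ^ m * M.choose m := by gcongr
    _ = (((M : ℝ) - b - m) ^ m * M.choose m) / ((M : ℝ) - m) ^ m := by rw [div_pow]; ring
    _ ≤ ((M - b).choose m * ((M : ℝ) - m) ^ m) / ((M : ℝ) - m) ^ m := by gcongr
    _ = _ := by field_simp

/-- Chebyshev's inequality for the number of members of a family of disjoint `b`-subsets of `N` that
are avoided by a random `m`-subset of `N`. -/
theorem card_filter_avoided_le {α ι : Type*} [DecidableEq α] [DecidableEq ι] {N : Finset α}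
    {B : Finset ι} {E : ι → Finset α} {b : ℕ} (hEN : ∀ v ∈ B, E v ⊆ N) (hEb : ∀ v ∈ B, (E v).card = b)
    (hdisj : ∀ u ∈ B, ∀ v ∈ B, u ≠ v → Disjoint (E u) (E v)) {m : ℕ} (hm : m ≤ N.card)
    {t : ℝ} (ht : t < B.card * (((N.card - b).choose m : ℝ) / N.card.choose m)) :
    (((N.powersetCard m).filter fun R =>
        ((B.filter fun v => Disjoint R (E v)).card : ℝ) ≤ t).card : ℝ) / N.card.choose m ≤
      B.card / (B.card * (((N.card - b).choose m : ℝ) / N.card.choose m) - t) ^ 2 := by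
  set Ω := N.powersetCard m with hΩ
  set Z : Finset α → ℝ := fun R => ((B.filter fun v => Disjoint R (E v)).card : ℝ) with hZ
  set T : ℝ := (N.card.choose m : ℝ) with hT
  set p : ℝ := ((N.card - b).choose m : ℝ) / T with hp
  have hT0 : 0 < T := by rw [hT]; exact_mod_cast Nat.choose_pos hm
  have hΩc : (Ω.card : ℝ) = T := by rw [hΩ, card_powersetCard]
  have hpT : ((N.card - b).choose m : ℝ) = p * T := by rw [hp]; field_simp
  have hZsum : ∀ R, Z R = ∑ v ∈ B, if Disjoint R (E v) then (1 : ℝ) else 0 := by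
    intro R; simp [hZ]
  have hsingle : ∀ v ∈ B, ∑ R ∈ Ω, (if Disjoint R (E v) then (1 : ℝ) else 0) = p * T := by
    intro v hv
    rw [sum_boole, card_filter_disjoint_powersetCard (hEN v hv), hEb v hv, hpT]
  have hfirst : ∑ R ∈ Ω, Z R = B.card * (p * T) := by
    simp only [hZsum]
    rw [sum_comm, sum_congr rfl hsingle, sum_const, nsmul_eq_mul]
  have hpair : ∀ u ∈ B, ∀ v ∈ B, ∑ R ∈ Ω, (if Disjoint R (E u) then (1 : ℝ) else 0) *
      (if Disjoint R (E v) then (1 : ℝ) else 0) ≤ p ^ 2 * T + if u = v then T else 0 := by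
    intro u hu v hv
    split_ifs with huv
    · calc _ ≤ ∑ _R ∈ Ω, (1 : ℝ) := by
            refine sum_le_sum fun R _ => ?_
            split_ifs <;> norm_num
        _ = T := by rw [sum_const, nsmul_eq_mul, mul_one, hΩc]
        _ ≤ _ := by linarith [mul_nonneg (sq_nonneg p) hT0.le]
    · have h1 : ∀ R, (if Disjoint R (E u) then (1 : ℝ) else 0) *
          (if Disjoint R (E v) then (1 : ℝ) else 0) =
          if Disjoint R (E u ∪ E v) then (1 : ℝ) else 0 := by
        intro R
        by_cases hu : Disjoint R (E u) <;> by_cases hv : Disjoint R (E v) <;>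
          simp [disjoint_union_right, hu, hv]
      simp only [h1]
      rw [sum_boole, card_filter_disjoint_powersetCard (union_subset (hEN u hu) (hEN v hv)),
        card_union_of_disjoint (hdisj u hu v hv huv), hEb u hu, hEb v hv, ← two_mul, add_zero]
      have h2 : ((N.card - 2 * b).choose m : ℝ) * T ≤ (p * T) ^ 2 := by
        rw [← hpT, hT]; exact_mod_cast choose_mul_choose_le N.card b m
      refine le_of_mul_le_mul_right ?_ hT0
      calc _ ≤ (p * T) ^ 2 := h2
        _ = _ := by ring
  have hsecond : ∑ R ∈ Ω, Z R ^ 2 ≤ B.card ^ 2 * (p ^ 2 * T) + B.card * T := by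
    calc ∑ R ∈ Ω, Z R ^ 2 = ∑ u ∈ B, ∑ v ∈ B, ∑ R ∈ Ω, (if Disjoint R (E u) then (1 : ℝ) else 0) *
          (if Disjoint R (E v) then (1 : ℝ) else 0) := by
          simp only [hZsum, sq, sum_mul_sum]
          rw [sum_comm]
          refine sum_congr rfl fun u _ => sum_comm
      _ ≤ ∑ u ∈ B, ∑ v ∈ B, (p ^ 2 * T + if u = v then T else 0) :=
          sum_le_sum fun u hu => sum_le_sum fun v hv => hpair u hu v hv
      _ = _ := by
          simp only [sum_add_distrib, sum_const, nsmul_eq_mul, sum_ite_eq, sum_ite_mem, inter_self]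
          ring
  have hvar : ∑ R ∈ Ω, (Z R - B.card * p) ^ 2 ≤ B.card * T := by
    have : ∑ R ∈ Ω, (Z R - B.card * p) ^ 2 =
        ∑ R ∈ Ω, Z R ^ 2 - 2 * (B.card * p) * ∑ R ∈ Ω, Z R + T * (B.card * p) ^ 2 := by
      have hconst : ∑ _R ∈ Ω, (B.card * p : ℝ) ^ 2 = T * (B.card * p) ^ 2 := by
        rw [sum_const, nsmul_eq_mul, hΩc]
      rw [← hconst, mul_sum, ← sum_sub_distrib, ← sum_add_distrib]
      exact sum_congr rfl fun R _ => by ring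
    rw [this, hfirst]
    nlinarith
  have hpos : 0 < B.card * p - t := by linarith
  rw [div_le_div_iff₀ hT0 (by positivity)]
  refine le_trans ?_ hvar
  calc _ = ∑ _R ∈ Ω.filter fun R => Z R ≤ t, (B.card * p - t) ^ 2 := by
          rw [sum_const, nsmul_eq_mul]
    _ ≤ ∑ R ∈ Ω.filter fun R => Z R ≤ t, (Z R - B.card * p) ^ 2 := by
          refine sum_le_sum fun R hR => ?_
          have := (mem_filter.1 hR).2
          nlinarith
    _ ≤ _ := sum_le_sum_of_subset_of_nonneg (filter_subset _ _) fun _ _ _ => sq_nonneg _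

end Avoiding

/-! ### Unbalanced complete bipartite digraphs -/

section LowerBound

/-- The bidirected complete bipartite digraph with classes `{0, …, k - 1}` and `{k, …, n - 1}`. -/
def bipartiteDigraph (n k : ℕ) : Digraph (Fin n) where
  Adj x y := ¬ (x.val < k ↔ y.val < k)

theorem card_filter_val_lt {n k : ℕ} (hk : k ≤ n) :
    (univ.filter fun x : Fin n => x.val < k).card = k := by
  rw [Fin.card_filter_val_lt, min_eq_right hk]

theorem card_filter_not_val_lt {n k : ℕ} (hk : k ≤ n) :
    (univ.filter fun x : Fin n => ¬ x.val < k).card = n - k := by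
  have := card_filter_add_card_filter_not (s := univ) (fun x : Fin n => x.val < k)
  rw [card_filter_val_lt hk, card_univ, Fintype.card_fin] at this
  omega

theorem isUnbalancedBipartite_bipartiteDigraph {n k : ℕ} (hk : 2 * k < n) :
    IsUnbalancedBipartite (bipartiteDigraph n k) := by
  refine ⟨univ.filter fun x => x.val < k, ?_, fun x y => ?_⟩
  · rwa [card_filter_val_lt (by omega), Fintype.card_fin]
  · simp only [bipartiteDigraph, mem_filter, mem_univ, true_and]
    tauto

theorem bipartiteDigraph_mem_denseDigraphs {n k : ℕ} {d : ℝ} (hk : k ≤ n) (h1 : d * n ≤ k)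
    (h2 : d * n ≤ (n : ℝ) - k) : bipartiteDigraph n k ∈ DenseDigraphs n d := by
  classical
  rw [← Nat.cast_sub hk] at h2
  have key : ∀ v : Fin n, d * n ≤ (univ.filter fun w : Fin n => ¬ (v.val < k ↔ w.val < k)).card := by
    intro v
    by_cases hv : v.val < k
    · simp only [hv, true_iff, card_filter_not_val_lt hk]; exact h2
    · simp only [hv, false_iff, not_not, card_filter_val_lt hk]; exact h1
  intro v
  refine ⟨?_, ?_⟩
  · convert key v using 2
    unfold outDeg
    congr!
  · convert key v using 2
    unfold inDeg
    refine congrArg card (filter_congr fun w _ => ?_)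
    simp only [bipartiteDigraph]
    tauto

/-- The pairs of vertices of the second class with the given second component. -/
def arcsWithin (n k : ℕ) (v : Fin n) : Finset (Fin n × Fin n) :=
  (univ.filter fun x : Fin n => ¬ x.val < k) ×ˢ {v}

/-- On a Hamilton cycle, the vertices of the second class which receive no random arc from their own
class have predecessors in the first class. -/
theorem card_avoided_le_of_isHamiltonian {n k : ℕ} (hk : k ≤ n) {R : Finset (Fin n × Fin n)}
    (h : IsHamiltonianDigraph (addArcs (bipartiteDigraph n k) R)) {S : Finset (Fin n)}
    (hS : ∀ v ∈ S, ¬ v.val < k ∧ Disjoint R (arcsWithin n k v)) : S.card ≤ k := by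
  obtain ⟨c, hc⟩ := h
  refine (card_le_card_of_injOn (t := univ.filter fun x : Fin n => x.val < k)
    (fun v => c (c.symm v - 1)) (fun v hv => ?_) ?_).trans_eq (card_filter_val_lt hk)
  · replace hv := hS v hv
    simp only [mem_coe, mem_filter, mem_univ, true_and]
    have hadj := hc (c.symm v - 1)
    rw [sub_add_cancel, Equiv.apply_symm_apply] at hadj
    by_contra hlt
    rcases hadj with h | h
    · exact h ⟨fun h => absurd h hlt, fun h => absurd h hv.1⟩
    · exact disjoint_left.1 hv.2 h (by simp only [arcsWithin, mem_product, mem_filter, mem_univ,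
        true_and, mem_singleton, and_true]; exact hlt)
  · intro u _ v _ huv
    exact c.symm.injective (sub_left_injective (c.injective huv))

/-- A sparse random digraph leaves more than `k` vertices of the second class without an arc from
this class, if `k` is about `d n`: the expected number of these vertices is at least about
`(1 - d) n · √d`. -/
theorem eventually_le_randomArcProb_not_isHamiltonian {d : ℝ} (hd0 : 0 < d) (hd : d ≤ 1 / 10)
    {ε : ℝ} (hε : 0 < ε) :
    ∀ᶠ n : ℕ in atTop, ∀ m : ℕ, (m : ℝ) < Real.log d⁻¹ * (n : ℝ) / 3 →
      1 - ε ≤ randomArcProb (bipartiteDigraph n ⌈d * n⌉₊) m fun D => ¬ IsHamiltonianDigraph D := by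
  classical
  set θ := Real.log d⁻¹ with hθ
  set s := √d with hs
  have hs0 : 0 < s := Real.sqrt_pos.2 hd0
  have hss : s * s = d := Real.mul_self_sqrt hd0.le
  have hs1 : s ≤ 32 / 100 := by nlinarith
  have hθ0 : 0 < θ := Real.log_pos ((one_lt_inv₀ hd0).2 (by linarith))
  have hsθ : Real.exp (-(θ / 2)) = s := by
    rw [hθ, Real.log_inv, hs, Real.sqrt_eq_rpow, Real.rpow_def_of_pos hd0]
    ring_nf
  have hN := tendsto_natCast_atTop_atTop (R := ℝ)
  filter_upwards [hN.eventually (eventually_ge_atTop 20),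
    hN.eventually (eventually_ge_atTop (10 * θ)), hN.eventually (eventually_ge_atTop (100 / 8 / s)),
    hN.eventually (eventually_ge_atTop (100 / 16 / (d * ε)))] with n hn hnθ hns hnε m hm
  rw [div_le_iff₀ hs0] at hns
  rw [div_le_iff₀ (by positivity)] at hnε
  have hn0 : (0 : ℝ) < n := by linarith
  set k := ⌈d * n⌉₊ with hk
  have hk' : (k : ℝ) < d * n + 1 := Nat.ceil_lt_add_one (by positivity)
  have hdn : d * n ≤ n / 10 := by nlinarith
  have hkn : k ≤ n := by
    have : (k : ℝ) ≤ n := by linarith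
    exact_mod_cast this
  set H := bipartiteDigraph n k with hH
  set N := nonArcs H with hNdef
  set B := univ.filter fun x : Fin n => ¬ x.val < k with hB
  set b := n - k with hb
  have hBc : B.card = b := card_filter_not_val_lt hkn
  have hbn : (b : ℝ) = n - k := Nat.cast_sub hkn
  have hb8 : 8 / 10 * n ≤ (b : ℝ) := by linarith
  have hbn' : (b : ℝ) ≤ n := by rw [hbn]; linarith [Nat.cast_nonneg (α := ℝ) k]
  have hEN : ∀ v ∈ B, arcsWithin n k v ⊆ N := by
    rintro v hv ⟨x, y⟩ hxy
    simp only [arcsWithin, mem_product, mem_filter, mem_univ, true_and, mem_singleton] at hxy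
    obtain ⟨hx, rfl⟩ := hxy
    have hy := (mem_filter.1 hv).2
    simp only [hNdef, hH, nonArcs, bipartiteDigraph, mem_filter, mem_univ, true_and, not_not]
    exact ⟨fun h => absurd h hx, fun h => absurd h hy⟩
  have hEb : ∀ v ∈ B, (arcsWithin n k v).card = b := by
    intro v _
    rw [arcsWithin, card_product, card_singleton, mul_one, card_filter_not_val_lt hkn]
  have hdisj : ∀ u ∈ B, ∀ v ∈ B, u ≠ v → Disjoint (arcsWithin n k u) (arcsWithin n k v) := by
    intro u _ v _ huv
    rw [disjoint_left]
    rintro ⟨x, y⟩ h1 h2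
    simp only [arcsWithin, mem_product, mem_singleton] at h1 h2
    exact huv (h1.2.symm.trans h2.2)
  have hNb : b * b ≤ N.card := by
    calc b * b = (B.biUnion (arcsWithin n k)).card := by
          rw [card_biUnion hdisj, sum_congr rfl hEb, sum_const, smul_eq_mul, hBc]
      _ ≤ N.card := card_le_card (biUnion_subset.2 hEN)
  have hNb' : (b : ℝ) * b ≤ N.card := by exact_mod_cast hNb
  -- the fraction of `m`-sets that avoid a given one of the sets of `b` pairs is at least `√d`
  have hmb : (m : ℝ) * b ≤ θ / 2 * ((N.card : ℝ) - b - m) := by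
    have h1 : (m : ℝ) * b ≤ θ * n / 3 * b := by gcongr
    have h2 : (n : ℝ) / 3 * b ≤ 1 / 2 * (b * b - b - θ * n / 3) := by nlinarith
    calc (m : ℝ) * b ≤ θ * n / 3 * b := h1
      _ = θ * (n / 3 * b) := by ring
      _ ≤ θ * (1 / 2 * (b * b - b - θ * n / 3)) := by gcongr
      _ ≤ θ * (1 / 2 * (N.card - b - m)) := by gcongr
      _ = _ := by ring
  have hmN : (m : ℝ) + b < N.card := by
    have h2 : θ * n / 3 + b < b * b := by nlinarith
    linarith
  have hmN' : m + b < N.card := by exact_mod_cast hmN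
  have hp : s ≤ ((N.card - b).choose m : ℝ) / N.card.choose m := by
    refine le_trans ?_ (exp_le_choose_div_choose hmN')
    rw [← hsθ]
    apply Real.exp_le_exp.2
    rw [neg_le_neg_iff, div_le_iff₀ (by linarith)]
    exact hmb
  set p := ((N.card - b).choose m : ℝ) / N.card.choose m with hpdef
  have hgap : 4 / 10 * s * n ≤ B.card * p - k := by
    rw [hBc]
    have h1 : 8 / 10 * n * s ≤ b * p := by gcongr
    have h2 : d * n ≤ 32 / 100 * s * n := by rw [← hss]; gcongr
    linarith
  have hsn : 0 < 4 / 10 * s * n := by positivity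
  have cheb := card_filter_avoided_le hEN hEb hdisj (m := m) (t := k) (by omega) (by linarith)
  have hbound : (B.card : ℝ) / (B.card * p - k) ^ 2 ≤ ε := by
    calc (B.card : ℝ) / (B.card * p - k) ^ 2 ≤ n / (4 / 10 * s * n) ^ 2 := by
          rw [hBc] at hgap ⊢
          gcongr
      _ = 100 / 16 / (d * n) := by rw [← hss]; field_simp; norm_num
      _ ≤ ε := by
          rw [div_le_iff₀ (by positivity)]
          linarith
  have hpos : (0 : ℝ) < N.card.choose m := by exact_mod_cast Nat.choose_pos (by omega)
  have hsplit := card_filter_add_card_filter_not (s := N.powersetCard m)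
    (fun R => IsHamiltonianDigraph (addArcs H R))
  rw [card_powersetCard] at hsplit
  have hprob : randomArcProb H m (fun D => ¬ IsHamiltonianDigraph D) =
      ((N.powersetCard m).filter fun R => ¬ IsHamiltonianDigraph (addArcs H R)).card /
        N.card.choose m := by
    unfold randomArcProb
    rw [card_powersetCard]
    congr!
  have hham : (((N.powersetCard m).filter fun R => IsHamiltonianDigraph (addArcs H R)).card : ℝ) /
      N.card.choose m ≤ ε := by
    refine le_trans ?_ (cheb.trans hbound)
    refine div_le_div_of_nonneg_right (Nat.cast_le.2 (card_le_card fun R hR => ?_)) hpos.le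
    rw [mem_filter] at hR ⊢
    refine ⟨hR.1, Nat.cast_le.2 (card_avoided_le_of_isHamiltonian hkn hR.2 fun v hv => ?_)⟩
    rw [mem_filter] at hv
    exact ⟨(mem_filter.1 hv.1).2, hv.2⟩
  have hone : (((N.powersetCard m).filter fun R => IsHamiltonianDigraph (addArcs H R)).card : ℝ) /
      N.card.choose m + ((N.powersetCard m).filter fun R =>
        ¬ IsHamiltonianDigraph (addArcs H R)).card / N.card.choose m = 1 := by
    rw [← add_div, div_eq_one_iff_eq hpos.ne']
    exact_mod_cast hsplit
  rw [hprob]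
  linarith

end LowerBound

theorem theorem3 (d : ℝ) (hd0 : 0 < d) (hd : d < 1 / 2) :
    (∀ ε : ℝ, 0 < ε → ∀ᶠ n : ℕ in atTop, ∀ H : Digraph (Fin n), H ∈ DenseDigraphs n d →
      ∀ m : ℕ, (d⁻¹ * (15 + 6 * Real.log d⁻¹) + 5 * d⁻¹ ^ 2) * (n : ℝ) ≤ (m : ℝ) →
        m ≤ (nonArcs H).card →
          1 - ε ≤ randomArcProb H m IsHamiltonianDigraph) ∧
    (d ≤ 1 / 10 → ∃ H : (n : ℕ) → Digraph (Fin n),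
      (∀ n : ℕ, 3 ≤ n → H n ∈ DenseDigraphs n d ∧ IsUnbalancedBipartite (H n)) ∧
      ∀ ε : ℝ, 0 < ε → ∀ᶠ n : ℕ in atTop, ∀ m : ℕ, (m : ℝ) < Real.log d⁻¹ * (n : ℝ) / 3 →
        1 - ε ≤ randomArcProb (H n) m (fun D => ¬ IsHamiltonianDigraph D)) := by
  refine ⟨fun ε hε => eventually_le_randomArcProb_isHamiltonian hd0 hd hε, fun hd10 =>
    ⟨fun n => bipartiteDigraph n ⌈d * n⌉₊, fun n hn => ?_,
      fun ε hε => eventually_le_randomArcProb_not_isHamiltonian hd0 hd10 hε⟩⟩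
  have hn3 : (3 : ℝ) ≤ n := by exact_mod_cast hn
  have hk := Nat.le_ceil (d * n)
  have hk' : (⌈d * n⌉₊ : ℝ) < d * n + 1 := Nat.ceil_lt_add_one (by positivity)
  have hdn : d * n ≤ n / 10 := by nlinarith
  have h2 : 2 * ⌈d * n⌉₊ < n := by
    have : (2 : ℝ) * ⌈d * n⌉₊ < n := by linarith
    exact_mod_cast this
  exact ⟨bipartiteDigraph_mem_denseDigraphs (by omega) hk (by linarith),
    isUnbalancedBipartite_bipartiteDigraph h2⟩
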